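/- A \emph{loose graph} $\Gamma=(V,E,\mathbf I)$ (possibly infinite) consists of a set $V$ of vertices, a set $E$ of edges and an incidence relation such that every edge is incident with at most two vertices and two distinct vertices are incident with at most one common edge. Its automorphism group $\mathrm{Aut}(\Gamma)$ consists of the pairs (permutation of $V$, permutation of $E$) that preserve incidence. Let $V'$ be a set of new vertices, one on each edge having exactly one vertex. Let $\overline\Gamma$ be the simple graph on $V\cup V'$ obtained from $\Gamma$ by adding these vertices, viewed in the complete graph $\mathbb P(\Gamma)$ on $V\cup V'$. Let $R=\mathbb F_1[X_i]_{i\in V\cup V'}$ be the graded monoid consisting of $0$ and the monomials in the $X_i$, and let $I$ be the ideal of $R$ generated by the $X_iX_j$ for which $i\neq j$ and $\{i,j\}$ is not an edge of $\overline\Gamma$. For a commutative graded monoid $M$ with zero, $\mathrm{Proj}(M)$ is the set of prime ideals of $M$ not containing the irrelevant ideal (all prime ideals contain $0$), with the Zariski topology and the sheaf of monoids whose sections are the functions that are locally given by fractions, with value at $\mathfrak p$ in the monoid $M_{(\mathfrak p)}$ of fractions of elements of equal degree in $M_{\mathfrak p}$. The Deitmar (monoidal) scheme $S(\Gamma)$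 is defined as follows. (I) If $\Gamma$ is a graph (every edge has exactly two vertices), then $S(\Gamma)=\mathrm{Proj}(R/I)$, a closed subscheme of the projective space $\mathrm{Proj}(R)$. (II) If $\Gamma$ is not a graph and the complement $\Gamma^c$ of $\Gamma$ in $\mathbb P(\Gamma)$ is a graph (every edge of $\mathbb P(\Gamma)$ which is not an edge of $\overline\Gamma$ has both ends in $V'$; the vertex set of $\Gamma^c$ is $V'$), then $S(\Gamma)$ is the open subscheme of $\mathrm{Proj}(R)$ which is the complement of the closed set of $\Gamma^c$, i.e. of the zero locus of the ideal generated by the $X_i$ with $i$ not a vertex of $\Gamma^c$ and the $X_iX_j$ with $i\ne j$ and $\{i,j\}$ not an edge of $\Gamma^c$. (III) In the remaining case, $S(\Gamma)$ is the intersection of the closed subscheme $\mathrm{Proj}(R/I)$ of $\mathrm{Proj}(R)$ with the open complement of the projective subspace on $V'$ (the zero locus of the $X_v$, $v\in V$). Theorem. For every loose graph $\Gamma$ in which each edge is incident with at least one vertex (in particular, for every graph and for every connected loose graph without isolated edges), there is an isomorphism of groups $$\mathrm{Aut}(\Gamma)\cong\mathrm{Aut}(S(\Gamma)),$$ where $\mathrm{Aut}(S(\Gamma))$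 is the group of automorphisms of $S(\Gamma)$ as a Deitmar scheme, i.e. in the category of topological spaces with a sheaf of commutative monoids and local morphisms. -/

import Mathlib

open CategoryTheory TopologicalSpace Opposite

universe u v

noncomputable section

namespace FOne

/-! ### Ideals, prime ideals and quotients of commutative monoids with zero -/

section Monoids

variable {M : Type u} [CommMonoidWithZero M]

/-- An ideal of a commutative monoid with zero. -/
@[ext]
structure MonoidIdeal (M : Type u) [CommMonoidWithZero M] where
  carrier : Set M
  zero_mem : (0 : M) ∈ carrier
  mul_mem : ∀ a x : M, x ∈ carrier → a * x ∈ carrier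

instance : SetLike (MonoidIdeal M) M where
  coe := MonoidIdeal.carrier
  coe_injective _ _ h := MonoidIdeal.ext h

/-- The ideal generated by a set. -/
def MonoidIdeal.span (S : Set M) : MonoidIdeal M where
  carrier := {x | x = 0 ∨ ∃ s ∈ S, s ∣ x}
  zero_mem := Or.inl rfl
  mul_mem a x := by
    rintro (rfl | ⟨s, hs, h⟩)
    · exact Or.inl (mul_zero a)
    · exact Or.inr ⟨s, hs, h.mul_left a⟩

/-- A prime ideal: the complement is a submonoid. -/
structure MonoidIdeal.IsPrime (p : MonoidIdeal M) : Prop where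
  one_notMem : (1 : M) ∉ p
  mem_or_mem : ∀ x y : M, x * y ∈ p → x ∈ p ∨ y ∈ p

/-- The complement of a prime ideal, as a submonoid. -/
def MonoidIdeal.IsPrime.compl {p : MonoidIdeal M} (hp : p.IsPrime) : Submonoid M where
  carrier := {x | x ∉ p}
  one_mem' := hp.one_notMem
  mul_mem' {x y} hx hy h := (hp.mem_or_mem x y h).elim hx hy

/-- The congruence which identifies all elements of an ideal with `0`. -/
def MonoidIdeal.con (I : MonoidIdeal M) : Con M where
  r x y := x = y ∨ (x ∈ I ∧ y ∈ I)
  iseqv :=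
    { refl := fun _ => Or.inl rfl
      symm := by
        rintro x y (h | h)
        · exact Or.inl h.symm
        · exact Or.inr h.symm
      trans := by
        rintro x y z (rfl | ⟨hx, hy⟩) (rfl | ⟨hy', hz⟩)
        · exact Or.inl rfl
        · exact Or.inr ⟨hy', hz⟩
        · exact Or.inr ⟨hx, hy⟩
        · exact Or.inr ⟨hx, hz⟩ }
  mul' := by
    have key : ∀ a x : M, x ∈ I → x * a ∈ I := fun a x hx => by
      rw [mul_comm]; exact I.mul_mem a x hx
    rintro w x y z (rfl | ⟨hw, hx⟩) (rfl | ⟨hy, hz⟩)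
    · exact Or.inl rfl
    · exact Or.inr ⟨I.mul_mem _ _ hy, I.mul_mem _ _ hz⟩
    · exact Or.inr ⟨key _ _ hw, key _ _ hx⟩
    · exact Or.inr ⟨key _ _ hw, key _ _ hx⟩

/-- The monoid quotient `M / I`. -/
def MonoidIdeal.Quotient (I : MonoidIdeal M) : Type u := I.con.Quotient

/-- The quotient map `M → M / I`. -/
def MonoidIdeal.toQuotient (I : MonoidIdeal M) (x : M) : I.Quotient := I.con.toQuotient x

instance (I : MonoidIdeal M) : CommMonoid I.Quotient :=
  inferInstanceAs (CommMonoid I.con.Quotient)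

instance (I : MonoidIdeal M) : CommMonoidWithZero I.Quotient where
  zero := I.toQuotient 0
  zero_mul := by
    rintro ⟨a⟩
    exact congrArg I.toQuotient (zero_mul a)
  mul_zero := by
    rintro ⟨a⟩
    exact congrArg I.toQuotient (mul_zero a)

/-- A grading `M = ⨁ M_i` by the natural numbers: every element is homogeneous, and a nonzero
element has a unique degree. -/
structure Grading (M : Type u) [CommMonoidWithZero M] where
  deg : ℕ → Set M
  zero_mem : ∀ i, (0 : M) ∈ deg i
  one_mem : (1 : M) ∈ deg 0
  mul_mem : ∀ i j x y, x ∈ deg i → y ∈ deg j → x * y ∈ deg (i + j)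
  exists_mem : ∀ x, ∃ i, x ∈ deg i
  eq_of_mem : ∀ i j x, x ≠ 0 → x ∈ deg i → x ∈ deg j → i = j

/-- The grading induced on a quotient by an ideal. -/
def Grading.quotient (𝒜 : Grading M) (I : MonoidIdeal M) : Grading I.Quotient where
  deg i := I.toQuotient '' 𝒜.deg i
  zero_mem i := ⟨0, 𝒜.zero_mem i, rfl⟩
  one_mem := ⟨1, 𝒜.one_mem, rfl⟩
  mul_mem := by
    rintro i j _ _ ⟨x, hx, rfl⟩ ⟨y, hy, rfl⟩
    exact ⟨x * y, 𝒜.mul_mem i j x y hx hy, rfl⟩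
  exists_mem := by
    rintro ⟨x⟩
    obtain ⟨i, hi⟩ := 𝒜.exists_mem x
    exact ⟨i, x, hi, rfl⟩
  eq_of_mem := by
    rintro i j _ h0 ⟨x, hx, rfl⟩ ⟨y, hy, hxy⟩
    have hxI : x ∉ I := fun h => h0 ((Con.eq I.con).2 (Or.inr ⟨h, I.zero_mem⟩))
    rcases (Con.eq I.con).1 hxy with rfl | ⟨-, h⟩
    · refine 𝒜.eq_of_mem i j y ?_ hx hy
      rintro rfl
      exact hxI I.zero_mem
    · exact absurd h hxI

end Monoids

/-! ### Monoidal spaces -/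

/-- A monoidal space: a topological space with a sheaf of commutative monoids. -/
structure MonoidalSpace where
  toSheafedSpace : AlgebraicGeometry.SheafedSpace CommMonCat.{u}

/-- The locality condition on a morphism of spaces with a sheaf of monoids. The germ of a section
is a unit of the stalk exactly if the section is a unit on some neighbourhood, so this says that
all the maps on stalks `𝒪_{Y, f x} → 𝒪_{X, x}` reflect units. -/
def IsLocal {X Y : AlgebraicGeometry.SheafedSpace CommMonCat.{u}} (f : X ⟶ Y) : Prop :=
  ∀ (x : X) (V : Opens Y) (s : Y.presheaf.obj (op V)) (W : Opens X)
    (i : W ⟶ (Opens.map f.hom.base).obj V), x ∈ W →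
    IsUnit (X.presheaf.map i.op (f.hom.c.app (op V) s)) →
    ∃ (W' : Opens Y) (j : W' ⟶ V), f.hom.base x ∈ W' ∧ IsUnit (Y.presheaf.map j.op s)

theorem IsLocal.id (X : AlgebraicGeometry.SheafedSpace CommMonCat.{u}) : IsLocal (𝟙 X) :=
  fun _ _ _ W i hx h => ⟨W, i, hx, h⟩

theorem IsLocal.comp {X Y Z : AlgebraicGeometry.SheafedSpace CommMonCat.{u}} {f : X ⟶ Y}
    {g : Y ⟶ Z} (hf : IsLocal f) (hg : IsLocal g) : IsLocal (f ≫ g) := by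
  intro x V s W i hx h
  obtain ⟨W', j, hx', h'⟩ := hf x ((Opens.map g.hom.base).obj V) (g.hom.c.app (op V) s) W i hx h
  exact hg (f.hom.base x) V s W' j hx' h'

/-- Morphisms of monoidal spaces are local. -/
@[ext]
structure MonoidalSpace.Hom (X Y : MonoidalSpace.{u}) where
  hom : X.toSheafedSpace ⟶ Y.toSheafedSpace
  isLocal : IsLocal hom

/-- The category of monoidal spaces and local morphisms. Deitmar schemes are a full subcategory. -/
instance : Category MonoidalSpace.{u} where
  Hom X Y := MonoidalSpace.Hom X Y
  id X := ⟨𝟙 X.toSheafedSpace, IsLocal.id _⟩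
  comp f g := ⟨f.hom ≫ g.hom, f.isLocal.comp g.isLocal⟩

/-- The open subspace of a monoidal space. -/
def MonoidalSpace.restrict (X : MonoidalSpace.{u}) (U : Opens X.toSheafedSpace) :
    MonoidalSpace.{u} :=
  ⟨X.toSheafedSpace.restrict U.isOpenEmbedding⟩

/-! ### The `Proj` construction -/

section Proj

variable {M : Type u} [CommMonoidWithZero M] (𝒜 : Grading M)

/-- The points of `Proj`: the prime ideals which do not contain the irrelevant ideal. -/
structure ProjPt where
  ideal : MonoidIdeal M
  isPrime : ideal.IsPrime
  not_irrelevant : ∃ i, 0 < i ∧ ∃ x ∈ 𝒜.deg i, x ∉ ideal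

variable {𝒜} in
/-- `V(I)`. -/
def zeroLocus (I : MonoidIdeal M) : Set (ProjPt 𝒜) := {p | ∀ x ∈ I, x ∈ p.ideal}

/-- The closed sets are the sets `V(I)` for the ideals `I`. -/
instance : TopologicalSpace (ProjPt 𝒜) :=
  TopologicalSpace.ofClosed {Z | ∃ I : MonoidIdeal M, Z = zeroLocus I}
    ⟨⟨Set.univ, trivial, fun _ _ _ => trivial⟩, by
      ext p
      exact ⟨fun h => h.elim, fun h => p.isPrime.one_notMem (h 1 trivial)⟩⟩
    (by
      intro A hA
      refine ⟨MonoidIdeal.span {x | ∃ I : MonoidIdeal M, zeroLocus I ∈ A ∧ x ∈ I}, ?_⟩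
      ext p
      constructor
      · rintro h x (rfl | ⟨s, ⟨I, hI, hs⟩, ⟨c, rfl⟩⟩)
        · exact p.ideal.zero_mem
        · rw [mul_comm]
          exact p.ideal.mul_mem _ _ (h _ hI s hs)
      · intro h Z hZ
        obtain ⟨I, rfl⟩ := hA hZ
        exact fun x hx => h x (Or.inr ⟨x, ⟨I, hZ, hx⟩, dvd_rfl⟩))
    (by
      rintro _ ⟨I, rfl⟩ _ ⟨J, rfl⟩
      refine ⟨⟨{x | x ∈ I ∧ x ∈ J}, ⟨I.zero_mem, J.zero_mem⟩,
        fun a x hx => ⟨I.mul_mem a x hx.1, J.mul_mem a x hx.2⟩⟩, ?_⟩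
      ext p
      constructor
      · rintro (h | h) x hx
        · exact h x hx.1
        · exact h x hx.2
      · intro h
        by_contra hcon
        simp only [Set.mem_union, not_or, zeroLocus, Set.mem_ofPred_eq, not_forall] at hcon
        obtain ⟨⟨x, hx, hxp⟩, ⟨y, hy, hyp⟩⟩ := hcon
        have hxy : x * y ∈ p.ideal :=
          h (x * y) ⟨by rw [mul_comm]; exact I.mul_mem y x hx, J.mul_mem x y hy⟩
        exact (p.isPrime.mem_or_mem x y hxy).elim hxp hyp)

theorem isClosed_zeroLocus (I : MonoidIdeal M) : IsClosed (zeroLocus I : Set (ProjPt 𝒜)) := by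
  refine ⟨?_⟩
  exact ⟨I, compl_compl _⟩

/-- The open set `D(I)`, the complement of `V(I)`. -/
def basicOpens (I : MonoidIdeal M) : Opens (ProjPt 𝒜) :=
  ⟨(zeroLocus I)ᶜ, (isClosed_zeroLocus 𝒜 I).isOpen_compl⟩

variable {𝒜}

/-- `M_{(p)}`: the fractions in `M_p` of elements of the same degree. -/
def ProjPt.fractions (p : ProjPt 𝒜) : Submonoid (Localization p.isPrime.compl) where
  carrier := {z | ∃ (i : ℕ) (a : M) (s : p.isPrime.compl),
    a ∈ 𝒜.deg i ∧ (s : M) ∈ 𝒜.deg i ∧ z = Localization.mk a s}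
  one_mem' := ⟨0, 1, 1, 𝒜.one_mem, 𝒜.one_mem, Localization.mk_one.symm⟩
  mul_mem' := by
    rintro _ _ ⟨i, a, s, ha, hs, rfl⟩ ⟨j, b, t, hb, ht, rfl⟩
    exact ⟨i + j, a * b, s * t, 𝒜.mul_mem _ _ _ _ ha hb, 𝒜.mul_mem _ _ _ _ hs ht,
      Localization.mk_mul a b s t⟩

variable (𝒜)

/-- The functions on an open set with values in the `M_{(p)}` which are given by one fraction. -/
def isFraction : TopCat.PrelocalPredicate (X := TopCat.of (ProjPt 𝒜))
    (fun p : ProjPt 𝒜 => p.fractions) where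
  pred {U} f := ∃ a b : M, ∀ q : U, ∃ hb : b ∈ q.1.isPrime.compl,
    ((f q : q.1.fractions) : Localization q.1.isPrime.compl) = Localization.mk a ⟨b, hb⟩
  res := by
    rintro U V i f ⟨a, b, h⟩
    exact ⟨a, b, fun q => h ⟨q.1, i.le q.2⟩⟩

/-- The functions which locally are given by one fraction. -/
def isLocallyFraction : TopCat.LocalPredicate (X := TopCat.of (ProjPt 𝒜))
    (fun p : ProjPt 𝒜 => p.fractions) :=
  (isFraction 𝒜).sheafify

/-- The sections over an open set, as a monoid under pointwise multiplication. -/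
def sectionsSubmonoid (U : (Opens (TopCat.of (ProjPt 𝒜)))ᵒᵖ) :
    Submonoid (∀ p : U.unop, (p : ProjPt 𝒜).fractions) where
  carrier := {f | (isLocallyFraction 𝒜).pred f}
  one_mem' := fun x => ⟨U.unop, x.2, 𝟙 _, 1, 1, fun q =>
    ⟨q.1.isPrime.one_notMem, Localization.mk_one.symm⟩⟩
  mul_mem' := by
    intro f g hf hg x
    obtain ⟨V, hV, i, a, b, h⟩ := hf x
    obtain ⟨W, hW, j, c, d, k⟩ := hg x
    refine ⟨V ⊓ W, ⟨hV, hW⟩, Opens.infLELeft _ _ ≫ i, a * c, b * d, fun q => ?_⟩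
    obtain ⟨hb, e₁⟩ := h ⟨q.1, q.2.1⟩
    obtain ⟨hd, e₂⟩ := k ⟨q.1, q.2.2⟩
    exact ⟨q.1.isPrime.compl.mul_mem hb hd,
      (congrArg₂ (· * ·) e₁ e₂).trans (Localization.mk_mul a c ⟨b, hb⟩ ⟨d, hd⟩)⟩

/-- The structure sheaf as a sheaf of sets. -/
def structureSheafInType : TopCat.Sheaf (Type u) (TopCat.of (ProjPt 𝒜)) :=
  TopCat.subsheafToTypes (isLocallyFraction 𝒜)

instance (U : (Opens (TopCat.of (ProjPt 𝒜)))ᵒᵖ) :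
    CommMonoid ((structureSheafInType 𝒜).1.obj U) :=
  (sectionsSubmonoid 𝒜 U).toCommMonoid

/-- The structure sheaf as a presheaf of monoids. -/
def structurePresheaf : TopCat.Presheaf CommMonCat.{u} (TopCat.of (ProjPt 𝒜)) where
  obj U := CommMonCat.of ((structureSheafInType 𝒜).1.obj U)
  map i := CommMonCat.ofHom
    { toFun := (structureSheafInType 𝒜).1.map i
      map_one' := rfl
      map_mul' := fun _ _ => rfl }

theorem structurePresheaf_isSheaf : (structurePresheaf 𝒜).IsSheaf :=
  (TopCat.Presheaf.isSheaf_iff_isSheaf_comp (forget CommMonCat) _).mpr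
    (TopCat.Presheaf.isSheaf_of_iso
      (NatIso.ofComponents (fun _ => Iso.refl _) (by cat_disch))
      (structureSheafInType 𝒜).property)

/-- `Proj(M)` as a monoidal space. -/
def Proj : MonoidalSpace.{u} where
  toSheafedSpace :=
    { carrier := TopCat.of (ProjPt 𝒜)
      presheaf := structurePresheaf 𝒜
      IsSheaf := structurePresheaf_isSheaf 𝒜 }

end Proj

/-! ### Polynomials over `𝔽₁` and the coordinate monoid of a graph -/

section Poly

variable (σ : Type u)

/-- `𝔽₁[X_i]_{i ∈ σ}`: the monomials in the `X_i`, together with `0`. -/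
abbrev Poly : Type u := WithZero (Multiplicative (σ →₀ ℕ))

variable {σ} in
/-- The variable `X_i`. -/
def X (i : σ) : Poly σ := ((Multiplicative.ofAdd (Finsupp.single i 1) : Multiplicative (σ →₀ ℕ)) :)

/-- The grading of `𝔽₁[X_i]` by total degree. -/
def polyGrading : Grading (Poly σ) where
  deg n := {x | ∀ m : σ →₀ ℕ, x = ((Multiplicative.ofAdd m : Multiplicative (σ →₀ ℕ)) : Poly σ) →
    m.degree = n}
  zero_mem i m h := absurd h.symm WithZero.coe_ne_zero
  one_mem m h := by
    have h1 : (1 : Multiplicative (σ →₀ ℕ)) = Multiplicative.ofAdd m := WithZero.coe_injective h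
    have h2 : m = 0 := Multiplicative.ofAdd.injective h1.symm
    simp [h2]
  mul_mem i j x y hx hy m h := by
    induction x using WithZero.recZeroCoe with
    | zero => simp at h
    | coe a =>
      induction y using WithZero.recZeroCoe with
      | zero => simp at h
      | coe b =>
        have h1 : a * b = Multiplicative.ofAdd m :=
          WithZero.coe_injective ((WithZero.coe_mul a b).trans h)
        have h2 : a.toAdd + b.toAdd = m := congrArg Multiplicative.toAdd h1
        rw [← h2, map_add, hx a.toAdd rfl, hy b.toAdd rfl]
  exists_mem x := by
    induction x using WithZero.recZeroCoe with
    | zero => exact ⟨0, fun m h => absurd h.symm WithZero.coe_ne_zero⟩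
    | coe a =>
      refine ⟨a.toAdd.degree, fun m h => ?_⟩
      have h1 : a = Multiplicative.ofAdd m := WithZero.coe_injective h
      rw [h1]
      rfl
  eq_of_mem i j x h0 hi hj := by
    induction x using WithZero.recZeroCoe with
    | zero => exact absurd rfl h0
    | coe a => exact (hi a.toAdd rfl).symm.trans (hj a.toAdd rfl)

variable {σ}

/-- The ideal generated by the products `X_i X_j` for the pairs `{i, j}` which are not an edge. -/
def edgeIdeal (G : SimpleGraph σ) : MonoidIdeal (Poly σ) :=
  MonoidIdeal.span {x | ∃ i j, i ≠ j ∧ ¬ G.Adj i j ∧ x = X i * X j}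

/-- The grading of the coordinate monoid `𝔽₁[X_i] / (X_i X_j : {i, j} not an edge)`. -/
def graphGrading (G : SimpleGraph σ) : Grading (edgeIdeal G).Quotient :=
  (polyGrading σ).quotient (edgeIdeal G)

/-- The ideal of `𝔽₁[X_i]` which defines the closed set of projective space that corresponds to
the subgraph `D` of the complete graph on `σ`: generated by the `X_i` for the `i` which are not
vertices of `D`, and the `X_i X_j` for the pairs `{i, j}` which are not an edge of `D`. -/
def subgraphIdeal (D : (⊤ : SimpleGraph σ).Subgraph) : MonoidIdeal (Poly σ) :=
  MonoidIdeal.span ({x | ∃ i, i ∉ D.verts ∧ x = X i} ∪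
    {x | ∃ i j, i ≠ j ∧ ¬ D.Adj i j ∧ x = X i * X j})

end Poly

end FOne

/-! ### Loose graphs -/

/-- A loose graph with vertex set `V` and edge set `E`: each edge is incident with at most two
vertices, and two distinct vertices are on at most one common edge. -/
structure LooseGraph (V : Type u) (E : Type v) where
  Inc : V → E → Prop
  encard_le_two : ∀ e, {w | Inc w e}.encard ≤ 2
  edge_unique : ∀ w w' e e', w ≠ w' → Inc w e → Inc w' e → Inc w e' → Inc w' e' → e = e'

namespace LooseGraph

variable {V : Type u} {E : Type v} (Γ : LooseGraph V E)

/-- The automorphism group: the pairs of a permutation of the vertices and a permutation of the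
edges which preserve incidence. -/
def autGroup : Subgroup (Equiv.Perm V × Equiv.Perm E) where
  carrier := {g | ∀ w e, Γ.Inc (g.1 w) (g.2 e) ↔ Γ.Inc w e}
  one_mem' := fun _ _ => Iff.rfl
  mul_mem' {g h} hg hh w e := (hg (h.1 w) (h.2 e)).trans (hh w e)
  inv_mem' {g} hg w e := by
    simpa using (hg (g.1⁻¹ w) (g.2⁻¹ e)).symm

/-- A loose edge is incident with exactly one vertex. -/
def IsLoose (e : E) : Prop := {w | Γ.Inc w e}.encard = 1

/-- The vertices of the complete graph `ℙ(Γ)`: those of `Γ`, and a new one on each loose edge. -/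
abbrev PVert : Type (max u v) := V ⊕ {e : E // Γ.IsLoose e}

/-- The new vertices. -/
def newVerts : Set Γ.PVert := Set.range Sum.inr

/-- Incidence of the vertices of `ℙ(Γ)` with the edges of `Γ`. -/
def PInc : Γ.PVert → E → Prop
  | Sum.inl w, e => Γ.Inc w e
  | Sum.inr l, e => l.1 = e

/-- The graph theoretical completion of `Γ`, a subgraph of the complete graph `ℙ(Γ)`. -/
def completion : SimpleGraph Γ.PVert where
  Adj x y := x ≠ y ∧ ∃ e, Γ.PInc x e ∧ Γ.PInc y e
  symm := ⟨fun _ _ ⟨h, e, hx, hy⟩ => ⟨h.symm, e, hy, hx⟩⟩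
  loopless := ⟨fun _ h => h.1 rfl⟩

/-- The complement of `Γ` in `ℙ(Γ)`: its vertices are the new ones, its edges the edges of `ℙ(Γ)`
which are not in `Γ` and have both ends among these vertices. -/
def complement : (⊤ : SimpleGraph Γ.PVert).Subgraph where
  verts := Γ.newVerts
  Adj x y := x ≠ y ∧ ¬ Γ.completion.Adj x y ∧ x ∈ Γ.newVerts ∧ y ∈ Γ.newVerts
  adj_sub h := h.1
  edge_vert h := h.2.2.1
  symm := ⟨fun _ _ ⟨h, h', hx, hy⟩ => ⟨h.symm, fun k => h' k.symm, hy, hx⟩⟩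

/-- Type I: the graphs. -/
def IsTypeI : Prop := ∀ e, {w | Γ.Inc w e}.encard = 2

/-- Type II: the complements in `ℙ(Γ)` of graphs, i.e. every edge of the complete graph `ℙ(Γ)` is
an edge of `Γ` or of the graph `complement Γ`. -/
def IsTypeII : Prop :=
  ∀ x y, x ≠ y → ¬ Γ.completion.Adj x y → Γ.complement.Adj x y

open FOne

/-- The ideal of the coordinate monoid of the completion which defines the complete graph on the
new vertices: it is generated by the variables of the vertices of `Γ`. -/
def oldIdeal : MonoidIdeal (edgeIdeal Γ.completion).Quotient :=
  MonoidIdeal.span {x | ∃ w : V, x = (edgeIdeal Γ.completion).toQuotient (X (Sum.inl w))}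

open Classical in
/-- The Deitmar scheme `S(Γ)`.
* For a graph: the closed subscheme `Proj(𝔽₁[X_i] / (X_i X_j : {i, j} not an edge))` of `ℙ(Γ)`.
* For the complement of a graph: the open subscheme of the projective space `Proj(𝔽₁[X_i])` which
  is the complement of the closed set of that graph.
* Otherwise: the intersection of the closed subscheme of the completion and the complement of the
  projective subspace on the new vertices. -/
def S : MonoidalSpace.{max u v} :=
  if Γ.IsTypeI then
    Proj (graphGrading Γ.completion)
  else if Γ.IsTypeII then
    (Proj (polyGrading Γ.PVert)).restrict
      (basicOpens (polyGrading Γ.PVert) (subgraphIdeal Γ.complement))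
  else
    (Proj (graphGrading Γ.completion)).restrict
      (basicOpens (graphGrading Γ.completion) Γ.oldIdeal)

end LooseGraph

end

noncomputable section

namespace FOne

open AlgebraicGeometry

/-! ### Isomorphisms of monoidal spaces -/

/-! A prime ideal of the coordinate monoid of a graph `G` is determined by the variables outside it.
Products of non-adjacent variables are zero, so these variables form a clique, and every nonempty
clique occurs (`IsCoordinate.exists_supp_eq`). Specialization of points is reverse inclusion of
cliques. In all three types, `S Γ` is the union of the charts of the old vertices `B = V` in the
`Proj` of such a monoid, where `G` is the completion (types I and III) or the complete graph (type
II). Its points are therefore the cliques that meet `B`.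

An automorphism acts on these cliques by an order automorphism. The minimal cliques are the
singletons in `B`, and a vertex outside `B` is recovered from the edge to its unique neighbour in
`B`, so the action comes from a unique permutation of the vertices that preserves `G` and `B`
(`IsCliqueModel.exists_perm`). Conversely, such a permutation relabels the variables and induces an
automorphism of the scheme.

No other automorphisms exist, by rigidity (`eq_id_of_base`): if all points are fixed, pullback sends
`X_j / X_i` to a power `(X_j / X_i) ^ k` with `k ≥ 1`, and the inverse to an `l`-th power, so `l * k
= 1`. Sections are locally quotients of products of these coordinates, or zero, hence all are fixed.

It remains to identify `relGroup G B` with `Γ.autGroup`. Loose edges are recorded by the new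
vertices, and the other edges are determined by their two ends (`autEquivRelGroup`). In type II
there is a single old vertex, and the completion and the complete graph have the same `relGroup`. -/

theorem isLocal_of_inverse {X Y : SheafedSpace CommMonCat.{u}} (f : X ⟶ Y) (g : Y ⟶ X)
    (hfg : f ≫ g = 𝟙 X) (hgf : g ≫ f = 𝟙 Y) : IsLocal f := by
  intro x V s W i hx h
  have hV : (Opens.map g.hom.base).obj ((Opens.map f.hom.base).obj V) = V := by
    rw [← Opens.map_comp_obj, ← SheafedSpace.comp_hom_base, hgf]; rfl
  have hx' : g.hom.base (f.hom.base x) = x := by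
    have := congrArg (fun k : X ⟶ X => k.hom.base x) hfg
    exact this
  let j : (Opens.map g.hom.base).obj W ⟶ V := (Opens.map g.hom.base).map i ≫ eqToHom hV
  refine ⟨(Opens.map g.hom.base).obj W, j, ?_, ?_⟩
  · change g.hom.base (f.hom.base x) ∈ W
    rwa [hx']
  -- Pulling the unit back along `g` gives a unit, and pullback along `f` and then `g` is just
  -- restriction of `s`.
  · have h1 := h.map (g.hom.c.app (op W)).hom
    have h2 : (g.hom.c.app (op W)) (X.presheaf.map i.op (f.hom.c.app (op V) s)) =
        Y.presheaf.map j.op s := by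
      have e1 := ConcreteCategory.congr_hom (g.hom.c.naturality i.op) (f.hom.c.app (op V) s)
      have e2 := ConcreteCategory.congr_hom (SheafedSpace.congr_hom_app hgf (op V)) s
      refine e1.trans ?_
      have e3 : g.hom.c.app (op ((Opens.map f.hom.base).obj V)) (f.hom.c.app (op V) s) =
        Y.presheaf.map (eqToHom (congrArg op hV.symm)) s := e2
      refine (congrArg (Y.presheaf.map ((Opens.map g.hom.base).map i).op) e3).trans ?_
      have e4 := ConcreteCategory.congr_hom (Y.presheaf.map_comp
        (eqToHom (congrArg op hV.symm))
        ((Opens.map g.hom.base).map i).op) s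
      refine (Eq.symm e4).trans ?_
      rfl
    exact h2 ▸ h1

/-- An isomorphism of the underlying sheafed spaces is an isomorphism of monoidal spaces. -/
def MonoidalSpace.isoMk {X Y : MonoidalSpace.{u}} (e : X.toSheafedSpace ≅ Y.toSheafedSpace) :
    X ≅ Y where
  hom := ⟨e.hom, isLocal_of_inverse _ e.inv e.hom_inv_id e.inv_hom_id⟩
  inv := ⟨e.inv, isLocal_of_inverse _ e.hom e.inv_hom_id e.hom_inv_id⟩
  hom_inv_id := MonoidalSpace.Hom.ext e.hom_inv_id
  inv_hom_id := MonoidalSpace.Hom.ext e.inv_hom_id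

theorem MonoidalSpace.hom_inv_hom {X Y : MonoidalSpace.{u}} (e : X ≅ Y) :
    e.hom.hom ≫ e.inv.hom = 𝟙 X.toSheafedSpace :=
  congrArg MonoidalSpace.Hom.hom e.hom_inv_id

theorem MonoidalSpace.inv_hom_hom {X Y : MonoidalSpace.{u}} (e : X ≅ Y) :
    e.inv.hom ≫ e.hom.hom = 𝟙 Y.toSheafedSpace :=
  congrArg MonoidalSpace.Hom.hom e.inv_hom_id

/-- The homeomorphism underlying an isomorphism of monoidal spaces. -/
def MonoidalSpace.baseHomeo {X Y : MonoidalSpace.{u}} (e : X ≅ Y) :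
    X.toSheafedSpace ≃ₜ Y.toSheafedSpace where
  toFun := e.hom.hom.hom.base
  invFun := e.inv.hom.hom.base
  left_inv x := congrArg (fun k : X.toSheafedSpace ⟶ X.toSheafedSpace => k.hom.base x)
    (MonoidalSpace.hom_inv_hom e)
  right_inv x := congrArg (fun k : Y.toSheafedSpace ⟶ Y.toSheafedSpace => k.hom.base x)
    (MonoidalSpace.inv_hom_hom e)
  continuous_toFun := e.hom.hom.hom.base.hom.continuous
  continuous_invFun := e.inv.hom.hom.base.hom.continuous

/-- The action of the automorphism group on the points. -/
def MonoidalSpace.autToPerm (X : MonoidalSpace.{u}) : Aut X →* Equiv.Perm X.toSheafedSpace where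
  toFun e := (MonoidalSpace.baseHomeo e).toEquiv
  map_one' := rfl
  map_mul' _ _ := rfl

/-- Restriction to the whole space. -/
def MonoidalSpace.restrictTopIso (X : MonoidalSpace.{u}) : X.restrict ⊤ ≅ X :=
  MonoidalSpace.isoMk (SheafedSpace.restrictTopIso X.toSheafedSpace)

/-- The inclusion of `U` and its composite with `e` are open immersions with the same range, hence
differ by an isomorphism of their source. -/
theorem MonoidalSpace.exists_restrict_iso {X : MonoidalSpace.{u}} (e : X ≅ X)
    (U : Opens X.toSheafedSpace) (hU : ∀ x, e.hom.hom.hom.base x ∈ U ↔ x ∈ U) :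
    ∃ e' : X.restrict U ≅ X.restrict U,
      ∀ x : (X.restrict U).toSheafedSpace,
        (Subtype.val (e'.hom.hom.hom.base x) : X.toSheafedSpace) = e.hom.hom.hom.base x.1 := by
  let ι := (SheafedSpace.ofRestrict X.toSheafedSpace U.isOpenEmbedding)
  have h1 : IsIso e.hom.hom := ⟨e.inv.hom, hom_inv_hom e, inv_hom_hom e⟩
  have : PresheafedSpace.IsOpenImmersion ι.hom := PresheafedSpace.IsOpenImmersion.ofRestrict _ _
  have : IsIso e.hom.hom.hom := SheafedSpace.is_presheafedSpace_iso _
  have hr : Set.range (ι.hom ≫ e.hom.hom.hom).base = Set.range ι.hom.base := by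
    ext y
    constructor
    · rintro ⟨x, rfl⟩
      exact ⟨⟨e.hom.hom.hom.base x.1, (hU _).2 x.2⟩, rfl⟩
    · rintro ⟨x, rfl⟩
      obtain ⟨z, hz⟩ := (baseHomeo e).surjective x.1
      refine ⟨⟨z, (hU z).1 ?_⟩, hz⟩
      exact (show e.hom.hom.hom.base z = x.1 from hz) ▸ x.2
  let k := PresheafedSpace.IsOpenImmersion.isoOfRangeEq (ι.hom ≫ e.hom.hom.hom) ι.hom hr
  refine ⟨isoMk (SheafedSpace.isoMk k), fun x => ?_⟩
  have h2 : k.hom ≫ ι.hom = ι.hom ≫ e.hom.hom.hom :=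
    PresheafedSpace.IsOpenImmersion.lift_fac ι.hom (ι.hom ≫ e.hom.hom.hom) hr.le
  exact congrArg (fun l : (X.restrict U).toSheafedSpace.toPresheafedSpace ⟶
    X.toSheafedSpace.toPresheafedSpace => l.base x) h2


/-! ### Functoriality of `Proj` for graded automorphisms -/

section ProjIso

variable {M : Type u} [CommMonoidWithZero M]

/-- The preimage of an ideal under an automorphism. -/
def MonoidIdeal.comap (I : MonoidIdeal M) (η : M ≃* M) : MonoidIdeal M where
  carrier := {x | η x ∈ I}
  zero_mem := by
    change η 0 ∈ I
    rw [map_zero]; exact I.zero_mem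
  mul_mem a x hx := by
    change η (a * x) ∈ I
    rw [map_mul]; exact I.mul_mem _ _ hx

theorem MonoidIdeal.mem_comap {I : MonoidIdeal M} {η : M ≃* M} {x : M} :
    x ∈ I.comap η ↔ η x ∈ I := Iff.rfl

theorem MonoidIdeal.IsPrime.comap {p : MonoidIdeal M} (hp : p.IsPrime) (η : M ≃* M) :
    (p.comap η).IsPrime where
  one_notMem h := hp.one_notMem (map_one η ▸ mem_comap.1 h)
  mem_or_mem x y h := hp.mem_or_mem _ _ (map_mul η x y ▸ mem_comap.1 h)

variable {𝒜 : Grading M}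

/-- Automorphisms of a graded monoid. -/
def Grading.Preserves (𝒜 : Grading M) (η : M ≃* M) : Prop :=
  ∀ n x, η x ∈ 𝒜.deg n ↔ x ∈ 𝒜.deg n

theorem Grading.Preserves.symm {η : M ≃* M} (h : 𝒜.Preserves η) : 𝒜.Preserves η.symm :=
  fun n x => by rw [← h, η.apply_symm_apply]

/-- The map of points induced by a graded automorphism. -/
def ProjPt.comap (p : ProjPt 𝒜) (η : M ≃* M) (h : 𝒜.Preserves η) : ProjPt 𝒜 where
  ideal := p.ideal.comap η
  isPrime := p.isPrime.comap η
  not_irrelevant := by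
    obtain ⟨i, hi, x, hx, hxp⟩ := p.not_irrelevant
    refine ⟨i, hi, η.symm x, (h.symm i x).2 hx, fun hcon => hxp ?_⟩
    have := MonoidIdeal.mem_comap.1 hcon
    rwa [η.apply_symm_apply] at this

theorem ProjPt.ext' {p q : ProjPt 𝒜} (h : ∀ x, x ∈ p.ideal ↔ x ∈ q.ideal) : p = q := by
  obtain ⟨p, hp, hp'⟩ := p
  obtain ⟨q, hq, hq'⟩ := q
  have : p = q := SetLike.ext h
  subst this
  rfl

theorem ProjPt.comap_comap (p : ProjPt 𝒜) (η θ : M ≃* M) (h : 𝒜.Preserves η)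
    (h' : 𝒜.Preserves θ) (hηθ : ∀ x, η (θ x) = x) : (p.comap η h).comap θ h' = p :=
  ProjPt.ext' fun x => by
    change η (θ x) ∈ p.ideal ↔ _
    rw [hηθ]

theorem ProjPt.continuous_comap (η : M ≃* M) (h : 𝒜.Preserves η) :
    Continuous (fun p : ProjPt 𝒜 => p.comap η h) := by
  rw [continuous_iff_isClosed]
  rintro Z ⟨⟨I, hI⟩⟩
  obtain rfl : Z = zeroLocus I := by rw [← compl_compl Z, hI]
  convert isClosed_zeroLocus 𝒜 (I.comap η.symm) using 1
  ext p
  constructor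
  · intro hp x hx
    have := MonoidIdeal.mem_comap.1 (hp _ hx)
    rwa [η.apply_symm_apply] at this
  · intro hp x hx
    exact hp (η x) (MonoidIdeal.mem_comap.2 (by rwa [η.symm_apply_apply]))

/-- The isomorphism of localizations induced by an automorphism. -/
def locEquiv {p : MonoidIdeal M} (hp : p.IsPrime) (η : M ≃* M) :
    Localization (hp.comap η).compl ≃* Localization hp.compl :=
  (Localization.monoidOf (hp.comap η).compl).mulEquivOfMulEquiv (Localization.monoidOf hp.compl)
    (j := η) (by
      ext x
      constructor
      · rintro ⟨y, hy, rfl⟩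
        exact hy
      · intro hx
        refine ⟨η.symm x, fun h => hx ?_, η.apply_symm_apply x⟩
        have := MonoidIdeal.mem_comap.1 h
        rwa [η.apply_symm_apply] at this)

theorem locEquiv_mk {p : MonoidIdeal M} (hp : p.IsPrime) (η : M ≃* M) (a : M)
    (s : (hp.comap η).compl) :
    locEquiv hp η (Localization.mk a s) = Localization.mk (η a) ⟨η s, s.2⟩ := by
  rw [Localization.mk_eq_monoidOf_mk'_apply, Localization.mk_eq_monoidOf_mk'_apply]
  exact Submonoid.LocalizationMap.mulEquivOfMulEquiv_mk' _ _ _ _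

/-- The map of fractions induced by a graded automorphism. -/
def fracMap (p : ProjPt 𝒜) (η : M ≃* M) (h : 𝒜.Preserves η) :
    (p.comap η h).fractions →* p.fractions where
  toFun z := ⟨locEquiv p.isPrime η z.1, by
    obtain ⟨_, i, a, s, ha, hs, rfl⟩ := z
    exact ⟨i, η a, ⟨η s, s.2⟩, (h i a).2 ha, (h i _).2 hs, locEquiv_mk _ _ _ _⟩⟩
  map_one' := Subtype.ext (map_one _)
  map_mul' _ _ := Subtype.ext (map_mul _ _ _)

theorem fracMap_injective (p : ProjPt 𝒜) (η : M ≃* M) (h : 𝒜.Preserves η) :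
    Function.Injective (fracMap p η h) := fun _ _ hxy =>
  Subtype.ext ((locEquiv p.isPrime η).injective (congrArg Subtype.val hxy))

theorem fracMap_eq_mk (p : ProjPt 𝒜) (η : M ≃* M) (h : 𝒜.Preserves η)
    (z : (p.comap η h).fractions) (a b : M) (hb : b ∈ (p.comap η h).isPrime.compl)
    (hz : (z : Localization _) = Localization.mk a ⟨b, hb⟩) :
    (fracMap p η h z : Localization p.isPrime.compl) = Localization.mk (η a) ⟨η b, hb⟩ := by
  change locEquiv p.isPrime η z.1 = _
  rw [hz]
  exact locEquiv_mk _ _ _ _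

/-- The homeomorphism of `Proj` induced by a graded automorphism. -/
def projHomeo (η : M ≃* M) (h : 𝒜.Preserves η) : ProjPt 𝒜 ≃ₜ ProjPt 𝒜 where
  toFun p := p.comap η h
  invFun p := p.comap η.symm h.symm
  left_inv p := p.comap_comap _ _ _ _ η.apply_symm_apply
  right_inv p := p.comap_comap _ _ _ _ η.symm_apply_apply
  continuous_toFun := ProjPt.continuous_comap η h
  continuous_invFun := ProjPt.continuous_comap _ h.symm

/-- The preimage of an open set. -/
def preimageOpens (η : M ≃* M) (h : 𝒜.Preserves η) (U : Opens (ProjPt 𝒜)) : Opens (ProjPt 𝒜) :=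
  ⟨{p | p.comap η h ∈ U}, U.2.preimage (ProjPt.continuous_comap η h)⟩

theorem sectionsMap_aux (η : M ≃* M) (h : 𝒜.Preserves η) {U V : Opens (ProjPt 𝒜)}
    (hV : ∀ p ∈ V, p.comap η h ∈ U) (s : ∀ p : U, (p : ProjPt 𝒜).fractions)
    (hs : (isLocallyFraction 𝒜).pred s) :
    (isLocallyFraction 𝒜).pred (U := V)
      fun p => fracMap p.1 η h (s ⟨p.1.comap η h, hV p.1 p.2⟩) := by
  intro p
  obtain ⟨W, hW, i, a, b, hab⟩ := hs ⟨p.1.comap η h, hV p.1 p.2⟩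
  refine ⟨V ⊓ preimageOpens η h W, ⟨p.2, hW⟩, Opens.infLELeft _ _, η a, η b, fun q => ?_⟩
  obtain ⟨hb, e⟩ := hab ⟨q.1.comap η h, q.2.2⟩
  exact ⟨hb, fracMap_eq_mk _ _ _ _ _ _ _ e⟩

/-- Pullback of sections along a graded automorphism. -/
def sectionsMap (η : M ≃* M) (h : 𝒜.Preserves η) (U : Opens (ProjPt 𝒜)) :
    sectionsSubmonoid 𝒜 (op U) →* sectionsSubmonoid 𝒜 (op (preimageOpens η h U)) where
  toFun s := ⟨fun p => fracMap p.1 η h (s.1 ⟨p.1.comap η h, p.2⟩),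
    sectionsMap_aux η h (fun _ hp => hp) s.1 s.2⟩
  map_one' := Subtype.ext (funext fun p => map_one (fracMap p.1 η h))
  map_mul' _ _ := Subtype.ext (funext fun p => map_mul (fracMap p.1 η h) _ _)

theorem sectionsMap_bijective (η : M ≃* M) (h : 𝒜.Preserves η)
    (U : Opens (ProjPt 𝒜)) : Function.Bijective (sectionsMap η h U) := by
  constructor
  · intro s t hst
    refine Subtype.ext (funext fun q => ?_)
    obtain ⟨q, hq⟩ := q
    obtain ⟨p, rfl⟩ := (projHomeo η h).surjective q
    exact fracMap_injective p η h (congrFun (congrArg Subtype.val hst) ⟨p, hq⟩)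
  · intro t
    have key (q : ProjPt 𝒜) (hq : q ∈ U) : q.comap η.symm h.symm ∈ preimageOpens η h U := by
      change (q.comap η.symm h.symm).comap η h ∈ U
      rwa [q.comap_comap _ _ _ _ η.symm_apply_apply]
    refine ⟨⟨fun q => fracMap q.1 η.symm h.symm (t.1 ⟨q.1.comap η.symm h.symm, key q.1 q.2⟩),
      sectionsMap_aux η.symm h.symm key t.1 t.2⟩, ?_⟩
    refine Subtype.ext (funext fun p => Subtype.ext ?_)
    -- The point `p` and its double `comap` are equal, but the values of `t` there lie in different
    -- types. They are compared through one fraction `a / b` that represents `t` near both.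
    obtain ⟨W, hW, i, a, b, hab⟩ := t.2 p
    have hp := p.1.comap_comap η η.symm h h.symm η.apply_symm_apply
    obtain ⟨hb, e⟩ := hab ⟨p.1, hW⟩
    obtain ⟨hb', e'⟩ := hab ⟨(p.1.comap η h).comap η.symm h.symm, by rw [hp]; exact hW⟩
    refine (fracMap_eq_mk p.1 η h _ _ _ _
      (fracMap_eq_mk (p.1.comap η h) η.symm h.symm _ _ _ hb' e')).trans ?_
    refine Eq.trans ?_ e.symm
    congr 1
    · exact η.apply_symm_apply a
    · exact Subtype.ext (η.apply_symm_apply b)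

/-- The automorphism of `Proj` induced by a graded automorphism. -/
def projIso (η : M ≃* M) (h : 𝒜.Preserves η) : Proj 𝒜 ≅ Proj 𝒜 :=
  MonoidalSpace.isoMk <| SheafedSpace.isoMk <|
    PresheafedSpace.isoOfComponents (X := (Proj 𝒜).toSheafedSpace.toPresheafedSpace)
      (Y := (Proj 𝒜).toSheafedSpace.toPresheafedSpace)
      (TopCat.isoOfHomeo (projHomeo η h))
      (NatIso.ofComponents (fun U =>
        MulEquiv.toCommMonCatIso (X := (structurePresheaf 𝒜).obj U)
          (Y := (structurePresheaf 𝒜).obj (op (preimageOpens η h U.unop)))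
          (MulEquiv.ofBijective _ (sectionsMap_bijective η h U.unop))) fun _ => rfl).symm

end ProjIso


/-! ### Sections over open subspaces of `Proj` -/

section Sections

variable {M : Type u} [CommMonoidWithZero M] {𝒜 : Grading M}

/-- The open set where `c` does not vanish. -/
def nonvanishing (𝒜 : Grading M) (c : M) : Opens (ProjPt 𝒜) :=
  basicOpens 𝒜 (MonoidIdeal.span {c})

theorem mem_nonvanishing {c : M} {p : ProjPt 𝒜} : p ∈ nonvanishing 𝒜 c ↔ c ∉ p.ideal := by
  refine not_congr ⟨fun h => h c (Or.inr ⟨c, rfl, dvd_rfl⟩), ?_⟩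
  rintro h x (rfl | ⟨s, rfl, d, rfl⟩)
  · exact p.ideal.zero_mem
  · rw [mul_comm]; exact p.ideal.mul_mem _ _ h

theorem specializes_iff_ideal_le {p q : ProjPt 𝒜} : q ⤳ p ↔ ∀ x ∈ q.ideal, x ∈ p.ideal := by
  rw [specializes_iff_forall_open]
  constructor
  · intro h x hx
    by_contra hxp
    exact mem_nonvanishing.1 (h _ (nonvanishing 𝒜 x).2 (mem_nonvanishing.2 hxp)) hx
  · rintro h s ⟨I, hI⟩ hp
    by_contra hq
    have : q ∈ sᶜ := hq
    rw [hI] at this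
    have h2 : p ∈ sᶜ := by
      rw [hI]
      exact fun x hx => h x (this x hx)
    exact h2 hp

variable (U : Opens (Proj 𝒜).toSheafedSpace)

/-- The points of an open subspace of `Proj`. -/
abbrev OpenPt : Type u := ((Proj 𝒜).restrict U).toSheafedSpace

/-- The sections over an open subset of an open subspace of `Proj`. -/
abbrev Sec (V : Opens (OpenPt U)) : Type u :=
  ((Proj 𝒜).restrict U).toSheafedSpace.presheaf.obj (op V)

variable {U}

/-- The underlying point of `Proj`. -/
def OpenPt.pt (q : OpenPt U) : ProjPt 𝒜 := Subtype.val q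

theorem OpenPt.pt_mem (q : OpenPt U) : q.pt ∈ U := q.2

theorem OpenPt.pt_injective : Function.Injective (OpenPt.pt : OpenPt U → ProjPt 𝒜) :=
  Subtype.val_injective

theorem OpenPt.continuous_pt : Continuous (OpenPt.pt : OpenPt U → ProjPt 𝒜) :=
  continuous_subtype_val

theorem OpenPt.specializes_iff {p q : OpenPt U} :
    q ⤳ p ↔ ∀ x ∈ q.pt.ideal, x ∈ p.pt.ideal :=
  (subtype_specializes_iff (X := ProjPt 𝒜) _ _).trans specializes_iff_ideal_le

/-- The trace of `nonvanishing` on an open subspace. -/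
def nv (U : Opens (Proj 𝒜).toSheafedSpace) (c : M) : Opens (OpenPt U) :=
  ⟨OpenPt.pt ⁻¹' (nonvanishing 𝒜 c), (nonvanishing 𝒜 c).2.preimage OpenPt.continuous_pt⟩

theorem mem_nv {c : M} {q : OpenPt U} : q ∈ nv U c ↔ c ∉ q.pt.ideal := mem_nonvanishing

/-- The image of an open subset of an open subspace. -/
abbrev imageOpens (V : Opens (OpenPt U)) : Opens (Proj 𝒜).toSheafedSpace :=
  U.isOpenEmbedding.functor.obj V

theorem mem_imageOpens {V : Opens (OpenPt U)} {q : OpenPt U} (h : q ∈ V) :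
    q.pt ∈ imageOpens V := ⟨q, h, rfl⟩

/-- The value of a section at a point. -/
def ev {V : Opens (OpenPt U)} (s : Sec U V) (q : OpenPt U) (hq : q ∈ V) :
    Localization q.pt.isPrime.compl :=
  ((show sectionsSubmonoid 𝒜 (op (imageOpens V)) from s).1 ⟨q.pt, mem_imageOpens hq⟩).1

section
variable {V W : Opens (OpenPt U)}

theorem ev_mul (s t : Sec U V) (q : OpenPt U) (hq : q ∈ V) :
    ev (s * t) q hq = ev s q hq * ev t q hq := rfl

theorem ev_one (q : OpenPt U) (hq : q ∈ V) : ev (1 : Sec U V) q hq = 1 := rfl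

theorem ev_ext {s t : Sec U V} (h : ∀ q hq, ev s q hq = ev t q hq) : s = t := by
  refine Subtype.ext (funext fun p => Subtype.ext ?_)
  obtain ⟨_, q, hq, rfl⟩ := p
  exact h q hq

theorem isUnit_ev {s : Sec U V} (h : IsUnit s) (q : OpenPt U) (hq : q ∈ V) :
    IsUnit (ev s q hq) := by
  obtain ⟨t, ht⟩ := h.exists_right_inv
  exact .of_mul_eq_one (ev t q hq) (by rw [← ev_mul, ht, ev_one])

/-- A section which is given by a single fraction. -/
def IsFrac (s : Sec U V) (a b : M) : Prop :=
  ∀ q hq, ∃ hb : b ∈ q.pt.isPrime.compl, ev s q hq = Localization.mk a ⟨b, hb⟩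

theorem exists_isFrac {n : ℕ} {a b : M} (ha : a ∈ 𝒜.deg n) (hb : b ∈ 𝒜.deg n)
    (hV : ∀ q ∈ V, b ∉ q.pt.ideal) : ∃ s : Sec U V, IsFrac s a b := by
  have hV' : ∀ p ∈ imageOpens V, b ∉ ProjPt.ideal (𝒜 := 𝒜) p := by
    rintro _ ⟨q, hq, rfl⟩
    exact hV q hq
  refine ⟨(⟨fun p => ⟨Localization.mk a ⟨b, hV' p.1 p.2⟩, n, a, ⟨b, hV' p.1 p.2⟩, ha, hb, rfl⟩,
    fun p => ⟨_, p.2, 𝟙 _, a, b, fun q => ⟨hV' q.1 q.2, rfl⟩⟩⟩ :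
      sectionsSubmonoid 𝒜 (op (imageOpens V))), fun q hq => ⟨hV q hq, rfl⟩⟩

theorem IsFrac.map {s : Sec U V} {a b : M} (h : IsFrac s a b) (i : op V ⟶ op W) :
    IsFrac (((Proj 𝒜).restrict U).toSheafedSpace.presheaf.map i s : Sec U W) a b :=
  fun q hq => h q (i.unop.le hq)

theorem IsFrac.mul {s t : Sec U V} {a b c d : M} (h : IsFrac s a b) (h' : IsFrac t c d) :
    IsFrac (s * t) (a * c) (b * d) := by
  intro q hq
  obtain ⟨hb, e⟩ := h q hq
  obtain ⟨hd, e'⟩ := h' q hq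
  exact ⟨q.pt.isPrime.compl.mul_mem hb hd, by rw [ev_mul, e, e', Localization.mk_mul]; rfl⟩

theorem IsFrac.ext {s t : Sec U V} {a b c d : M} (h : IsFrac s a b) (h' : IsFrac t c d)
    (heq : a * d = b * c) : s = t := by
  refine ev_ext fun q hq => ?_
  obtain ⟨hb, e⟩ := h q hq
  obtain ⟨hd, e'⟩ := h' q hq
  rw [e, e', Localization.mk_eq_mk_iff, Localization.r_iff_exists]
  exact ⟨1, by simp [mul_comm d, heq]⟩

theorem IsFrac.one : IsFrac (1 : Sec U V) 1 1 := fun q hq =>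
  ⟨q.pt.isPrime.one_notMem, (ev_one q hq).trans Localization.mk_one.symm⟩

theorem IsFrac.mul_eq_one {s t : Sec U V} {a b : M} (h : IsFrac s a b) (h' : IsFrac t b a) :
    s * t = 1 :=
  (h.mul h').ext IsFrac.one (by rw [mul_one, mul_one, mul_comm])

theorem isUnit_mk_iff {p : MonoidIdeal M} (hp : p.IsPrime) (a : M) (b : hp.compl) :
    IsUnit (Localization.mk a b) ↔ a ∉ p := by
  constructor
  · intro h ha
    obtain ⟨z, hz⟩ := h.exists_right_inv
    induction z using Localization.induction_on with
    | H y =>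
      obtain ⟨c, d⟩ := y
      rw [Localization.mk_mul, ← Localization.mk_one, Localization.mk_eq_mk_iff,
        Localization.r_iff_exists] at hz
      obtain ⟨e, he⟩ := hz
      have h1 : (e * (b * d) : M) ∉ p := (e * (b * d)).2
      apply h1
      simp only [Submonoid.coe_one, one_mul, mul_one, Submonoid.coe_mul] at he
      rw [← he, mul_comm a, ← mul_assoc]
      exact p.mul_mem _ _ ha
  · intro ha
    refine .of_mul_eq_one (Localization.mk (b : M) (⟨a, ha⟩ : hp.compl)) ?_
    rw [Localization.mk_mul, ← Localization.mk_one, Localization.mk_eq_mk_iff,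
      Localization.r_iff_exists]
    exact ⟨1, by simp [mul_comm a]⟩

/-- The fraction supplied by `isFraction` need not have numerator and denominator of equal degree.
The value at `p` does have such a representative `a / b`. The two agree after multiplication by some
`c` outside the prime of `p`, hence wherever `b` and `c` do not vanish. -/
theorem exists_local_isFrac (s : Sec U V) (p : OpenPt U) (hp : p ∈ V) :
    ∃ (W : Opens (OpenPt U)) (i : op V ⟶ op W) (n : ℕ) (a b : M), p ∈ W ∧ a ∈ 𝒜.deg n ∧
      b ∈ 𝒜.deg n ∧
      IsFrac (((Proj 𝒜).restrict U).toSheafedSpace.presheaf.map i s : Sec U W) a b := by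
  obtain ⟨W, hW, i, a', b', h⟩ :=
    (show sectionsSubmonoid 𝒜 (op (imageOpens V)) from s).2 ⟨p.pt, mem_imageOpens hp⟩
  obtain ⟨n, a, b, ha, hb, e⟩ :=
    ((show sectionsSubmonoid 𝒜 (op (imageOpens V)) from s).1 ⟨p.pt, mem_imageOpens hp⟩).2
  obtain ⟨hb', e'⟩ := h ⟨p.pt, hW⟩
  have e1 := e.symm.trans e'
  rw [Localization.mk_eq_mk_iff, Localization.r_iff_exists] at e1
  obtain ⟨c, hc⟩ := e1
  let W1 : Opens (OpenPt U) := ⟨OpenPt.pt ⁻¹' W, W.2.preimage OpenPt.continuous_pt⟩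
  let W' : Opens (OpenPt U) := V ⊓ (W1 ⊓ (nv U c.1 ⊓ nv U b.1))
  refine ⟨W', (homOfLE inf_le_left).op, n, a, b, ⟨hp, hW, mem_nv.2 c.2, mem_nv.2 b.2⟩, ha, hb,
    fun q hq => ⟨mem_nv.1 hq.2.2.2, ?_⟩⟩
  obtain ⟨hbq, e2⟩ := h ⟨q.pt, hq.2.1⟩
  refine Eq.trans e2 ?_
  rw [Localization.mk_eq_mk_iff, Localization.r_iff_exists]
  exact ⟨⟨c.1, mem_nv.1 hq.2.2.1⟩, hc.symm⟩

end

end Sections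


/-! ### Coordinate monoids of graphs -/

section Coordinates

variable {σ : Type u}

/-- The monomial with a given exponent. -/
def mono (m : σ →₀ ℕ) : Poly σ := ((Multiplicative.ofAdd m : Multiplicative (σ →₀ ℕ)) :)

theorem mono_add (m k : σ →₀ ℕ) : mono (m + k) = mono m * mono k := rfl

theorem mono_zero : mono (0 : σ →₀ ℕ) = 1 := rfl

theorem mono_single (i : σ) : mono (Finsupp.single i 1) = X i := rfl

theorem mono_injective : Function.Injective (mono : (σ →₀ ℕ) → Poly σ) := fun _ _ h =>
  Multiplicative.ofAdd.injective (WithZero.coe_injective h)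

theorem mono_ne_zero (m : σ →₀ ℕ) : mono m ≠ 0 := WithZero.coe_ne_zero

theorem eq_zero_or_mono (a : Poly σ) : a = 0 ∨ ∃ m, a = mono m := by
  induction a using WithZero.recZeroCoe with
  | zero => exact Or.inl rfl
  | coe a => exact Or.inr ⟨a.toAdd, rfl⟩

theorem mono_mem_deg {m : σ →₀ ℕ} {n : ℕ} : mono m ∈ (polyGrading σ).deg n ↔ m.degree = n :=
  ⟨fun h => h m rfl, fun h _ hk => mono_injective hk ▸ h⟩

theorem mono_dvd_mono {k m : σ →₀ ℕ} : mono k ∣ mono m ↔ k ≤ m := by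
  constructor
  · rintro ⟨c, hc⟩
    rcases eq_zero_or_mono c with rfl | ⟨l, rfl⟩
    · rw [mul_zero] at hc
      exact absurd hc (mono_ne_zero m)
    · rw [← mono_add] at hc
      rw [mono_injective hc]
      exact le_self_add
  · intro h
    exact ⟨mono (m - k), by rw [← mono_add, add_tsub_cancel_of_le h]⟩

theorem mono_mem_edgeIdeal {G : SimpleGraph σ} {m : σ →₀ ℕ} :
    mono m ∈ edgeIdeal G ↔ ∃ i j, i ≠ j ∧ ¬ G.Adj i j ∧ m i ≠ 0 ∧ m j ≠ 0 := by
  constructor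
  · rintro (h | ⟨_, ⟨i, j, hij, hadj, rfl⟩, h⟩)
    · exact absurd h (mono_ne_zero m)
    · rw [← mono_single, ← mono_single, ← mono_add, mono_dvd_mono] at h
      refine ⟨i, j, hij, hadj, ?_, ?_⟩
      · have := h i
        simp at this
        omega
      · have := h j
        simp at this
        omega
  · rintro ⟨i, j, hij, hadj, hi, hj⟩
    refine Or.inr ⟨_, ⟨i, j, hij, hadj, rfl⟩, ?_⟩
    rw [← mono_single, ← mono_single, ← mono_add, mono_dvd_mono]
    classical
    intro k
    simp only [Finsupp.add_apply, Finsupp.single_apply]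
    split_ifs with h1 h2 h2
    · exact absurd (h1.trans h2.symm) hij
    · subst h1; omega
    · subst h2; omega
    · exact Nat.zero_le _

/-! ### Primes of a coordinate monoid as cliques of the graph. -/

variable {M : Type u} [CommMonoidWithZero M] {𝒜 : Grading M} {G : SimpleGraph σ}

/-- `π` presents the graded monoid `M` as the coordinate monoid of the graph `G`. -/
structure IsCoordinate (𝒜 : Grading M) (G : SimpleGraph σ) (π : Poly σ →*₀ M) : Prop where
  surjective : Function.Surjective π
  eq_zero_iff : ∀ a, π a = 0 ↔ a ∈ edgeIdeal G
  eq_of_eq : ∀ a b, π a = π b → π a ≠ 0 → a = b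
  mem_deg : ∀ n x, x ∈ 𝒜.deg n ↔ ∃ a ∈ (polyGrading σ).deg n, π a = x

/-- The quotient map to the coordinate monoid. -/
def quotientHom (G : SimpleGraph σ) : Poly σ →*₀ (edgeIdeal G).Quotient where
  toFun := (edgeIdeal G).toQuotient
  map_zero' := rfl
  map_one' := rfl
  map_mul' _ _ := rfl

theorem isCoordinate_quotientHom (G : SimpleGraph σ) :
    IsCoordinate (graphGrading G) G (quotientHom G) where
  surjective := by
    rintro ⟨a⟩
    exact ⟨a, rfl⟩
  eq_zero_iff a := by
    refine (Con.eq (edgeIdeal G).con).trans ⟨?_, fun h => Or.inr ⟨h, (edgeIdeal G).zero_mem⟩⟩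
    rintro (rfl | h)
    · exact (edgeIdeal G).zero_mem
    · exact h.1
  eq_of_eq a b h h0 := by
    rcases (Con.eq (edgeIdeal G).con).1 h with h | h
    · exact h
    · exact absurd ((Con.eq (edgeIdeal G).con).2 (Or.inr ⟨h.1, (edgeIdeal G).zero_mem⟩)) h0
  mem_deg n x := Iff.rfl

/-- The complete graph has no non-edges, so its edge ideal is zero. This puts type II, which lives
in projective space, on the same footing as the other types. -/
theorem isCoordinate_id : IsCoordinate (polyGrading σ) ⊤ (MonoidWithZeroHom.id (Poly σ)) where
  surjective a := ⟨a, rfl⟩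
  eq_zero_iff a := by
    rcases eq_zero_or_mono a with rfl | ⟨m, rfl⟩
    · simp only [map_zero, true_iff]
      exact (edgeIdeal (⊤ : SimpleGraph σ)).zero_mem
    · refine ⟨fun h => absurd h (mono_ne_zero m), fun h => ?_⟩
      obtain ⟨i, j, hij, hadj, -⟩ := mono_mem_edgeIdeal.1 h
      exact absurd ((SimpleGraph.top_adj i j).2 hij) hadj
  eq_of_eq _ _ h _ := h
  mem_deg n x := by simp

namespace IsCoordinate

variable {π : Poly σ →*₀ M} (hπ : IsCoordinate 𝒜 G π)

include hπ

theorem mono_eq_zero_iff {m : σ →₀ ℕ} :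
    π (mono m) = 0 ↔ ∃ i j, i ≠ j ∧ ¬ G.Adj i j ∧ m i ≠ 0 ∧ m j ≠ 0 :=
  (hπ.eq_zero_iff _).trans mono_mem_edgeIdeal

theorem eq_zero_or_mono (x : M) : x = 0 ∨ ∃ m, x = π (mono m) := by
  obtain ⟨a, rfl⟩ := hπ.surjective x
  rcases FOne.eq_zero_or_mono a with rfl | ⟨m, rfl⟩
  · exact Or.inl (map_zero π)
  · exact Or.inr ⟨m, rfl⟩

theorem mono_mem_deg (m : σ →₀ ℕ) : π (mono m) ∈ 𝒜.deg m.degree :=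
  (hπ.mem_deg _ _).2 ⟨_, FOne.mono_mem_deg.2 rfl, rfl⟩

theorem X_mem_deg (i : σ) : π (X i) ∈ 𝒜.deg 1 := by
  have := hπ.mono_mem_deg (Finsupp.single i 1)
  rwa [Finsupp.degree_single] at this

theorem X_pow_mem_deg (i : σ) (n : ℕ) : π (X i) ^ n ∈ 𝒜.deg n := by
  induction n with
  | zero => rw [pow_zero]; exact 𝒜.one_mem
  | succ n ih => rw [pow_succ]; exact 𝒜.mul_mem _ _ _ _ ih (hπ.X_mem_deg i)

omit hπ in
theorem map_X_pow (i : σ) (n : ℕ) : π (X i) ^ n = π (mono (Finsupp.single i n)) := by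
  induction n with
  | zero => rw [pow_zero, Finsupp.single_zero, mono_zero, map_one]
  | succ n ih => rw [pow_succ, ih, Finsupp.single_add, mono_add, map_mul, mono_single]

theorem degree_eq {m : σ →₀ ℕ} {n : ℕ} (h : π (mono m) ∈ 𝒜.deg n) (h0 : π (mono m) ≠ 0) :
    m.degree = n := 𝒜.eq_of_mem _ _ _ h0 (hπ.mono_mem_deg m) h

omit hπ in
/-- The variables which do not vanish at a point. -/
def supp (π : Poly σ →*₀ M) (p : ProjPt 𝒜) : Set σ := {i | π (X i) ∉ p.ideal}

omit hπ in
-- A prime contains a monomial exactly if it contains one of its variables, so a point is determined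
-- by its `supp`.
theorem mono_notMem_iff {p : ProjPt 𝒜} {m : σ →₀ ℕ} :
    π (mono m) ∉ p.ideal ↔ ∀ i, m i ≠ 0 → i ∈ supp π p := by
  induction m using Finsupp.induction_linear with
  | zero => simpa [mono_zero] using p.isPrime.one_notMem
  | add f g hf hg =>
    rw [mono_add, map_mul]
    have h1 : π (mono f) * π (mono g) ∉ p.ideal ↔ π (mono f) ∉ p.ideal ∧ π (mono g) ∉ p.ideal := by
      constructor
      · intro h
        refine ⟨fun k => h ?_, fun k => h (p.ideal.mul_mem _ _ k)⟩
        rw [mul_comm]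
        exact p.ideal.mul_mem _ _ k
      · exact fun h => p.isPrime.compl.mul_mem h.1 h.2
    rw [h1, hf, hg]
    constructor
    · rintro ⟨h, k⟩ i hi
      by_cases hfi : f i = 0
      · refine k i fun hgi => hi ?_
        simp [hfi, hgi]
      · exact h i hfi
    · intro h
      exact ⟨fun i hi => h i (by simp [hi]), fun i hi => h i (by simp [hi])⟩
  | single i n =>
    rw [← map_X_pow]
    rcases Nat.eq_zero_or_pos n with rfl | hn
    · simpa using p.isPrime.one_notMem
    · constructor
      · intro h j hj
        obtain rfl : i = j := by
          by_contra hij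
          exact hj (Finsupp.single_eq_of_ne' hij)
        intro hX
        apply h
        obtain ⟨n, rfl⟩ := Nat.exists_eq_succ_of_ne_zero hn.ne'
        rw [pow_succ]
        exact p.ideal.mul_mem _ _ hX
      · intro h
        exact p.isPrime.compl.pow_mem (h i (by simp [hn.ne'])) n

theorem ideal_le_iff {p q : ProjPt 𝒜} :
    (∀ x ∈ q.ideal, x ∈ p.ideal) ↔ supp π p ⊆ supp π q := by
  constructor
  · exact fun h i hi hq => hi (h _ hq)
  · intro h x hx
    rcases hπ.eq_zero_or_mono x with rfl | ⟨m, rfl⟩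
    · exact p.ideal.zero_mem
    · by_contra hp
      exact mono_notMem_iff.2 (fun i hi => h (mono_notMem_iff.1 hp i hi)) hx

theorem supp_injective : Function.Injective (supp π : ProjPt 𝒜 → Set σ) := fun _ _ h =>
  ProjPt.ext' fun x => ⟨hπ.ideal_le_iff.2 h.ge x, hπ.ideal_le_iff.2 h.le x⟩

theorem isClique_supp (p : ProjPt 𝒜) : G.IsClique (supp π p) := by
  intro i hi j hj hij
  by_contra hadj
  have h0 : π (X i) * π (X j) = 0 := by
    rw [← map_mul]
    exact (hπ.eq_zero_iff _).2 (Or.inr ⟨_, ⟨i, j, hij, hadj, rfl⟩, dvd_rfl⟩)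
  have h1 : π (X i) * π (X j) ∉ p.ideal := p.isPrime.compl.mul_mem hi hj
  rw [h0] at h1
  exact h1 p.ideal.zero_mem

theorem mono_ne_zero_of_isClique {A : Set σ} (hA : G.IsClique A) {m : σ →₀ ℕ}
    (hm : ∀ i, m i ≠ 0 → i ∈ A) : π (mono m) ≠ 0 := fun h => by
  obtain ⟨i, j, hij, hadj, hi, hj⟩ := hπ.mono_eq_zero_iff.1 h
  exact hadj (hA (hm i hi) (hm j hj) hij)

/-- The prime consists of everything that is not a monomial in the variables of `A`. As `A` is a
clique, these monomials are nonzero in `M`, so their exponents are well defined. Primality holds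
because the support of a product of monomials is the union of the supports. A variable from `A`
keeps the irrelevant ideal from being contained in it. -/
theorem exists_supp_eq {A : Set σ} (hA : G.IsClique A) (hne : A.Nonempty) :
    ∃ p : ProjPt 𝒜, supp π p = A := by
  let I : MonoidIdeal M :=
    { carrier := {x | ∀ m, x = π (mono m) → ¬ ∀ i, m i ≠ 0 → i ∈ A}
      zero_mem := fun m hm h => hπ.mono_ne_zero_of_isClique hA h hm.symm
      mul_mem := fun a x hx m hm h => by
        have h0 := hπ.mono_ne_zero_of_isClique hA h
        rcases hπ.eq_zero_or_mono a with rfl | ⟨k, rfl⟩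
        · exact h0 (by rw [← hm, zero_mul])
        · rcases hπ.eq_zero_or_mono x with rfl | ⟨l, rfl⟩
          · exact h0 (by rw [← hm, mul_zero])
          · rw [← map_mul, ← mono_add] at hm
            have := mono_injective (hπ.eq_of_eq _ _ hm.symm h0)
            subst this
            exact hx l rfl fun i hi => h i (by simp [hi]) }
  have hI (m : σ →₀ ℕ) : π (mono m) ∉ I ↔ ∀ i, m i ≠ 0 → i ∈ A := by
    constructor
    · intro h
      by_contra hcon
      refine h fun k hk hkA => hcon ?_
      have := mono_injective (hπ.eq_of_eq _ _ hk.symm (hπ.mono_ne_zero_of_isClique hA hkA))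
      subst this
      exact hkA
    · exact fun h k => k m rfl h
  have hX (i : σ) : π (X i) ∉ I ↔ i ∈ A := by
    rw [← mono_single, hI]
    constructor
    · exact fun h => h i (by simp)
    · intro h j hj
      obtain rfl : i = j := by
        by_contra hij
        exact hj (Finsupp.single_eq_of_ne' hij)
      exact h
  refine ⟨⟨I, ⟨?_, ?_⟩, ?_⟩, Set.ext hX⟩
  · rw [← map_one π, ← mono_zero, hI]
    simp
  · intro x y hxy
    by_contra! hcon
    rcases hπ.eq_zero_or_mono x with rfl | ⟨k, rfl⟩
    · exact hcon.1 I.zero_mem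
    · rcases hπ.eq_zero_or_mono y with rfl | ⟨l, rfl⟩
      · exact hcon.2 I.zero_mem
      · rw [← map_mul, ← mono_add] at hxy
        refine (hI _).2 (fun i hi => ?_) hxy
        by_cases hk : k i = 0
        · exact (hI l).1 hcon.2 i fun hl => hi (by simp [hk, hl])
        · exact (hI k).1 hcon.1 i hk
  · obtain ⟨i, hi⟩ := hne
    exact ⟨1, one_pos, π (X i), hπ.X_mem_deg i, (hX i).2 hi⟩

theorem supp_nonempty (p : ProjPt 𝒜) : (supp π p).Nonempty := by
  obtain ⟨n, hn, x, hx, hxp⟩ := p.not_irrelevant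
  rcases hπ.eq_zero_or_mono x with rfl | ⟨m, rfl⟩
  · exact absurd p.ideal.zero_mem hxp
  · have hm : m ≠ 0 := by
      rintro rfl
      have := hπ.degree_eq hx (fun h => hxp (h ▸ p.ideal.zero_mem))
      simp at this
      omega
    obtain ⟨i, hi⟩ := Finsupp.ne_iff.1 hm
    exact ⟨i, mono_notMem_iff.1 hxp i hi⟩

end IsCoordinate

end Coordinates


/-! ### Rigidity: an automorphism which fixes the points is the identity -/

section Rigidity

variable {M : Type u} [CommMonoidWithZero M] {𝒜 : Grading M}
  {U : Opens (Proj 𝒜).toSheafedSpace}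

/-- The sheafed space of an open subspace of `Proj`. -/
abbrev projOpen (U : Opens (Proj 𝒜).toSheafedSpace) : SheafedSpace CommMonCat.{u} :=
  ((Proj 𝒜).restrict U).toSheafedSpace

/-- The preimage of an open set under an endomorphism. -/
abbrev pre (f : projOpen U ⟶ projOpen U) (V : Opens (OpenPt U)) : Opens (OpenPt U) :=
  (Opens.map f.hom.base).obj V

theorem pre_mono (f : projOpen U ⟶ projOpen U) {V W : Opens (OpenPt U)} (h : W ≤ V) :
    pre f W ≤ pre f V := fun _ hx => h hx

theorem mem_pre {f : projOpen U ⟶ projOpen U} (hf : ∀ q : OpenPt U, f.hom.base q = q)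
    {V : Opens (OpenPt U)} {q : OpenPt U} : q ∈ pre f V ↔ q ∈ V := by
  have h : f.hom.base q ∈ V ↔ q ∈ V := by rw [hf]
  exact h

/-- Pullback of sections along an endomorphism. -/
def pull (f : projOpen U ⟶ projOpen U) {V : Opens (OpenPt U)} :
    Sec U V →* Sec U (pre f V) :=
  (f.hom.c.app (op V)).hom

/-- Restriction of sections. -/
def res {V W : Opens (OpenPt U)} (h : W ≤ V) : Sec U V →* Sec U W :=
  ((projOpen U).presheaf.map (homOfLE h).op).hom

section

variable {V W : Opens (OpenPt U)} (f : projOpen U ⟶ projOpen U)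

theorem ev_res (h : W ≤ V) (s : Sec U V) (q : OpenPt U) (hq : q ∈ W) :
    ev (res h s) q hq = ev s q (h hq) := rfl

theorem IsFrac.res (h : W ≤ V) {s : Sec U V} {a b : M} (hs : IsFrac s a b) :
    IsFrac (res h s) a b := hs.map _

theorem pull_res (h : W ≤ V) (s : Sec U V) :
    pull f (res h s) = res (pre_mono f h) (pull f s) :=
  ConcreteCategory.congr_hom (f.hom.c.naturality (homOfLE h).op) s

/-- `f` fixes the values of the section `s`. -/
def Fixes (s : Sec U V) : Prop :=
  ∀ (q : OpenPt U) (hq : q ∈ V) (hq' : q ∈ pre f V),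
    ev (pull f s) q hq' = ev s q hq

variable {f}

theorem Fixes.mul {s t : Sec U V} (hs : Fixes f s) (ht : Fixes f t) : Fixes f (s * t) := by
  intro q hq hq'
  rw [map_mul, ev_mul, ev_mul, hs q hq hq', ht q hq hq']

theorem Fixes.one : Fixes f (1 : Sec U V) := by
  intro q hq hq'
  rw [map_one, ev_one, ev_one]

theorem Fixes.res (h : W ≤ V) {s : Sec U V} (hs : Fixes f s) : Fixes f (res h s) := by
  intro q hq hq'
  rw [pull_res, ev_res, ev_res]
  exact hs q (h hq) (h hq')

theorem pull_pull {f g : projOpen U ⟶ projOpen U} (hgf : g ≫ f = 𝟙 _) (s : Sec U V)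
    (q : OpenPt U) (hq : q ∈ V)
    (hq' : q ∈ pre g (pre f V)) :
    ev (pull g (pull f s)) q hq' = ev s q hq := by
  have e := ConcreteCategory.congr_hom (SheafedSpace.congr_hom_app hgf (op V)) s
  exact congrArg (fun t : Sec U (pre g (pre f V)) =>
    ev t q hq') e

theorem eq_id_of_fixes (hbase : f.hom.base = 𝟙 _)
    (h : ∀ (V : Opens (OpenPt U)) (s : Sec U V), Fixes f s) : f = 𝟙 _ := by
  refine SheafedSpace.ext _ _ hbase ?_
  refine NatTrans.ext (funext fun V => ?_)
  refine CommMonCat.hom_ext (MonoidHom.ext fun s => ?_)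
  induction V with
  | op V =>
    refine ev_ext (U := U) (V := V) fun q hq => ?_
    exact h V s q hq (by
      change f.hom.base q ∈ V
      rw [hbase]
      exact hq)

end

/-! ### Pullback of the coordinates `X_j / X_i`. -/

variable {σ : Type u} {G : SimpleGraph σ} {π : Poly σ →*₀ M} (hπ : IsCoordinate 𝒜 G π)
  {f g : projOpen U ⟶ projOpen U}

open IsCoordinate

/-- A larger support means a generization, and open sets are stable under generization. -/
theorem mem_of_supp_subset (hπ : IsCoordinate 𝒜 G π) {p q : OpenPt U} {V : Opens (OpenPt U)}
    (hp : p ∈ V) (h : supp π p.pt ⊆ supp π q.pt) : q ∈ V :=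
  (OpenPt.specializes_iff.2 (hπ.ideal_le_iff.2 h)).mem_open V.2 hp

theorem IsFrac.ev_eq {V : Opens (OpenPt U)} {s : Sec U V} {a b : M} (h : IsFrac s a b)
    {q : OpenPt U} (hq : q ∈ V) (hb : b ∈ q.pt.isPrime.compl) :
    ev s q hq = Localization.mk a ⟨b, hb⟩ := (h q hq).2

/-- A homomorphism of monoids need not preserve the absorbing element, so the inverse is used. The
zero section `z` satisfies `z * pull g z = z`. Applying `pull f` shows that `pull f z` is a multiple
of `z`, hence zero. -/
theorem fixes_zero (hfg : f ≫ g = 𝟙 _) {V : Opens (OpenPt U)} {s : Sec U V}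
    {b : M} (hs : IsFrac s 0 b) : Fixes f s := by
  obtain ⟨z, hz⟩ := exists_isFrac (U := U) (V := ⊤) (𝒜.zero_mem 0) 𝒜.one_mem
    fun q _ => q.pt.isPrime.one_notMem
  have h1 : Fixes f z := by
    intro q hq hq'
    let t : Sec U (⊤ : Opens (OpenPt U)) := pull g z
    have h2 : z * t = z := by
      refine ev_ext fun q hq => ?_
      rw [ev_mul, hz.ev_eq hq q.pt.isPrime.one_notMem]
      induction ev t q hq using Localization.induction_on with
      | H y =>
        rw [Localization.mk_mul, Localization.mk_eq_mk_iff, Localization.r_iff_exists]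
        exact ⟨1, by simp⟩
    have h3 := congrArg (fun t => ev (pull f t) q hq') h2
    simp only [map_mul, ev_mul] at h3
    have h4 := pull_pull hfg z q hq hq'
    rw [← h3]
    refine (congrArg (_ * ·) h4).trans ?_
    rw [hz.ev_eq hq q.pt.isPrime.one_notMem]
    induction ev (pull f z) q hq' using Localization.induction_on with
    | H y =>
      rw [Localization.mk_mul, Localization.mk_eq_mk_iff, Localization.r_iff_exists]
      exact ⟨1, by simp⟩
  have h5 : s = res le_top z := hs.ext (hz.res le_top) (by simp)
  rw [h5]
  exact h1.res _

theorem IsFrac.pow {V : Opens (OpenPt U)} {s : Sec U V} {a b : M} (h : IsFrac s a b) (n : ℕ) :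
    IsFrac (s ^ n) (a ^ n) (b ^ n) := by
  induction n with
  | zero => simpa using IsFrac.one
  | succ n ih => rw [pow_succ, pow_succ, pow_succ]; exact ih.mul h

theorem eq_single_add_single {i j : σ} (hij : i ≠ j) {m : σ →₀ ℕ}
    (hm : ∀ c, m c ≠ 0 → c = i ∨ c = j) :
    m = Finsupp.single i (m i) + Finsupp.single j (m j) := by
  classical
  ext c
  rw [Finsupp.add_apply, Finsupp.single_apply, Finsupp.single_apply]
  split_ifs with h1 h2 h2
  · exact absurd (h1.trans h2.symm) hij
  · subst h1; omega
  · subst h2; omega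
  · by_contra hc
    rcases hm c (by omega) with rfl | rfl
    · exact h1 rfl
    · exact h2 rfl

include hπ in
/-- The pullback of the coordinate `X_j / X_i` is a power of it. -/
theorem exists_pull_eq_pow (hloc : IsLocal f) (hbase : ∀ q : OpenPt U, f.hom.base q = q) {i j : σ}
    (hij : i ≠ j) {p p' : OpenPt U} (hp : supp π p.pt = {i}) (hp' : supp π p'.pt = {i, j})
    {s : Sec U (nv U (π (X i)))} (hs : IsFrac s (π (X j)) (π (X i))) :
    ∃ k, 1 ≤ k ∧ ∀ hW : pre f (nv U (π (X i))) ≤ nv U (π (X i)),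
      pull f s = res hW (s ^ k) := by
  have hmem (V : Opens (OpenPt U)) (q : OpenPt U) : q ∈ pre f V ↔ q ∈ V := mem_pre hbase
  have hpi : i ∈ supp π p.pt := by simp [hp]
  have hpi' : i ∈ supp π p'.pt := by simp [hp']
  have hpj' : j ∈ supp π p'.pt := by simp [hp']
  have hpW := (hmem _ p).2 (mem_nv.2 hpi)
  obtain ⟨W', iW, n, a, b, hpW', ha, hb, hfr⟩ := exists_local_isFrac (pull f s) p hpW
  -- Every point of the chart of `X_i` has `i` in its support and so specializes to `p`. A
  -- neighbourhood of `p` thus contains the whole chart, and the local fraction is valid on all of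
  -- it.
  have hfr' : IsFrac (pull f s) a b := fun q hq => hfr q <| mem_of_supp_subset hπ hpW' <| by
    rw [hp, Set.singleton_subset_iff]
    exact mem_nv.1 ((hmem _ q).1 hq)
  obtain ⟨hbp, -⟩ := hfr' p hpW
  -- At `p'` the coordinate `X_j / X_i` is invertible, hence so is its pullback. This makes `a` a
  -- monomial in `X_i` and `X_j`, while `b`, nonvanishing at `p`, is a power of `X_i`.
  have hunit : IsUnit (ev (pull f s) p' ((hmem _ p').2 (mem_nv.2 hpi'))) := by
    let D := nv U (π (X i)) ⊓ nv U (π (X j))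
    obtain ⟨u, hu⟩ := exists_isFrac (U := U) (V := D) (hπ.X_mem_deg i) (hπ.X_mem_deg j)
      fun q hq => mem_nv.1 hq.2
    have h1 : IsUnit (res (inf_le_left : D ≤ _) s) :=
      .of_mul_eq_one u ((hs.res inf_le_left).mul_eq_one hu)
    have h2 := isUnit_ev (h1.map (pull f)) p' ((hmem _ _).2 ⟨mem_nv.2 hpi', mem_nv.2 hpj'⟩)
    rwa [pull_res, ev_res] at h2
  obtain ⟨hbp', e⟩ := hfr' p' ((hmem _ p').2 (mem_nv.2 hpi'))
  rw [e, isUnit_mk_iff] at hunit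
  rcases hπ.eq_zero_or_mono a with rfl | ⟨m, rfl⟩
  · exact absurd p'.pt.ideal.zero_mem hunit
  rcases hπ.eq_zero_or_mono b with rfl | ⟨l, rfl⟩
  · exact absurd p.pt.ideal.zero_mem hbp
  have hm := mono_notMem_iff.1 hunit
  have hl := mono_notMem_iff.1 (show π (mono l) ∉ p.pt.ideal from hbp)
  rw [hp'] at hm
  rw [hp] at hl
  have hm' := eq_single_add_single hij hm
  have hl' := eq_single_add_single hij (m := l) fun c hc => Or.inl (hl c hc)
  have hlj : l j = 0 := by
    by_contra h
    exact hij (hl j h).symm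
  have hmn : m i + m j = n := by
    rw [← hπ.degree_eq ha fun h => hunit (h ▸ p'.pt.ideal.zero_mem), congrArg Finsupp.degree hm']
    simp
  have hln : l i = n := by
    rw [← hπ.degree_eq hb fun h => hbp (h ▸ p.pt.ideal.zero_mem), congrArg Finsupp.degree hl']
    simp [hlj]
  -- Since `a` and `b` have equal degree, `a / b = (X_j / X_i) ^ m j`, here in cross-multiplied
  -- form.
  have heq : π (mono m) * π (X i) ^ m j = π (mono l) * π (X j) ^ m j := by
    rw [map_X_pow, map_X_pow, ← map_mul, ← map_mul, ← mono_add, ← mono_add]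
    congr 2
    have h1 : l = Finsupp.single i (m i) + Finsupp.single i (m j) := by
      rw [hl', hlj, hln, ← hmn, Finsupp.single_zero, add_zero, Finsupp.single_add]
    rw [h1, add_right_comm, ← hm']
  refine ⟨m j, ?_, fun hW => hfr'.ext ((hs.pow _).res hW) heq⟩
  -- With exponent `0` the pullback would be `1`, a unit at `p`. Locality of `f` would then make
  -- `X_j / X_i` a unit at `p`, where `X_j` vanishes.
  by_contra hk
  have hk0 : m j = 0 := by omega
  rw [hk0, pow_zero, pow_zero, mul_one, mul_one] at heq
  have h1 : pull f s = 1 := hfr'.ext IsFrac.one (by rw [heq])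
  obtain ⟨W'', jW, hpW'', hu⟩ := hloc p _ s _ (𝟙 _) hpW (by
    have h2 : IsUnit (res (le_refl _) (pull f s)) := by rw [h1, map_one]; exact isUnit_one
    exact h2)
  rw [hbase] at hpW''
  have h3 := isUnit_ev (U := U) hu p hpW''
  obtain ⟨hi, e'⟩ := hs.map jW.op p hpW''
  rw [e', isUnit_mk_iff] at h3
  have h4 : j ∈ supp π p.pt := h3
  rw [hp] at h4
  exact hij h4.symm

include hπ in
theorem fixes_coordinate (hf : IsLocal f) (hg : IsLocal g) (hgf : g ≫ f = 𝟙 _)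
    (hfb : ∀ q : OpenPt U, f.hom.base q = q) (hgb : ∀ q : OpenPt U, g.hom.base q = q) {i j : σ}
    (hij : G.Adj i j) {p p' : OpenPt U} (hp : supp π p.pt = {i}) (hp' : supp π p'.pt = {i, j})
    {s : Sec U (nv U (π (X i)))} (hs : IsFrac s (π (X j)) (π (X i))) : Fixes f s := by
  obtain ⟨k, hk, ek⟩ := exists_pull_eq_pow hπ hf hfb hij.ne hp hp' hs
  obtain ⟨l, hl, el⟩ := exists_pull_eq_pow hπ hg hgb hij.ne hp hp' hs
  have hfW : pre f (nv U (π (X i))) ≤ nv U (π (X i)) := fun _ => (mem_pre hfb).1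
  have hgW : pre g (nv U (π (X i))) ≤ nv U (π (X i)) := fun _ => (mem_pre hgb).1
  have ek := ek hfW
  have el := el hgW
  have hpi : i ∈ supp π p.pt := by simp [hp]
  have hpi : p ∈ nv U (π (X i)) := mem_nv.2 hpi
  have hpp : p ∈ pre g (pre f (nv U (π (X i)))) :=
    (mem_pre hgb).2 ((mem_pre hfb).2 hpi)
  have h1 := pull_pull hgf s p hpi hpp
  rw [ek, pull_res, ev_res, map_pow, el, ← map_pow, ev_res, ← pow_mul] at h1
  obtain ⟨hb, e1⟩ := hs.pow (l * k) p hpi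
  rw [e1, hs.ev_eq hpi (mem_nv.1 hpi), Localization.mk_eq_mk_iff, Localization.r_iff_exists] at h1
  obtain ⟨⟨c, hc⟩, h2⟩ := h1
  -- The germs at `p` of `(X_j / X_i) ^ (l * k)` and `X_j / X_i` agree, up to a factor `c` that is a
  -- power of `X_i`. As `{i, j}` is a clique, the monomials involved are nonzero and their exponents
  -- at `j` can be compared.
  have hlk : l * k = 1 := by
    rcases hπ.eq_zero_or_mono c with rfl | ⟨m, rfl⟩
    · exact absurd p.pt.ideal.zero_mem hc
    have hm := mono_notMem_iff.1 (show π (mono m) ∉ p.pt.ideal from hc)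
    rw [hp] at hm
    change π (mono m) * (π (X i) * π (X j) ^ (l * k)) = π (mono m) * (π (X i) ^ (l * k) * π (X j))
      at h2
    rw [map_X_pow, map_X_pow, ← mono_single, ← mono_single, ← map_mul, ← map_mul, ← map_mul,
      ← map_mul, ← mono_add, ← mono_add, ← mono_add, ← mono_add] at h2
    have hcl : G.IsClique {i, j} := by
      rw [SimpleGraph.isClique_pair]
      exact fun _ => hij
    have h3 := mono_injective <| hπ.eq_of_eq _ _ h2 <| hπ.mono_ne_zero_of_isClique hcl <| by
      intro c hc
      by_contra hcon
      rw [Set.mem_insert_iff, Set.mem_singleton_iff, not_or] at hcon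
      have : m c = 0 := by
        by_contra h
        exact hcon.1 (hm c h)
      apply hc
      simp [this, Ne.symm hcon.1, Ne.symm hcon.2]
    have h4 := DFunLike.congr_fun h3 j
    simpa [hij.ne, hij.ne'] using h4
  have hk1 : k = 1 := Nat.eq_one_of_mul_eq_one_left hlk
  intro q hq hq'
  rw [ek, hk1, pow_one, ev_res]

include hπ in
/-- An automorphism which fixes all points is the identity, if the open subspace is the union of
the charts of some of the coordinates. -/
theorem eq_id_of_base (B : Set σ) (hU : ∀ p : ProjPt 𝒜, p ∈ U ↔ ∃ i ∈ B, i ∈ supp π p)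
    (hf : IsLocal f) (hg : IsLocal g) (hgf : g ≫ f = 𝟙 _) (hfg : f ≫ g = 𝟙 _)
    (hfb : ∀ q : OpenPt U, f.hom.base q = q) (hgb : ∀ q : OpenPt U, g.hom.base q = q) :
    f = 𝟙 _ := by
  have hcoord : ∀ i ∈ B, ∀ j, ∀ s : Sec U (nv U (π (X i))), IsFrac s (π (X j)) (π (X i)) →
      Fixes f s := by
    intro i hi j s hs
    by_cases hij : i = j
    · subst hij
      have : s = 1 := hs.ext IsFrac.one rfl
      rw [this]
      exact Fixes.one
    by_cases hadj : G.Adj i j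
    · obtain ⟨p, hp⟩ := hπ.exists_supp_eq (A := {i}) (by simp) (by simp)
      obtain ⟨p', hp'⟩ := hπ.exists_supp_eq (A := {i, j})
        (by rw [SimpleGraph.isClique_pair]; exact fun _ => hadj) (by simp)
      exact fixes_coordinate hπ hf hg hgf hfb hgb hadj
        (p := ⟨p, (hU p).2 ⟨i, hi, by simp [hp]⟩⟩) (p' := ⟨p', (hU p').2 ⟨i, hi, by simp [hp']⟩⟩)
        hp hp' hs
    -- For a non-edge, `X_j * X_i = 0` with `X_i` invertible on the chart, so the coordinate is the
    -- zero section.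
    · refine fixes_zero hfg (b := π (X i)) fun q hq => ?_
      obtain ⟨hb, e⟩ := hs q hq
      refine ⟨hb, e.trans ?_⟩
      have h0 : π (X j) * π (X i) = 0 := by
        rw [← map_mul]
        exact (hπ.eq_zero_iff _).2
          (Or.inr ⟨_, ⟨j, i, Ne.symm hij, fun h => hadj h.symm, rfl⟩, dvd_rfl⟩)
      rw [Localization.mk_eq_mk_iff, Localization.r_iff_exists]
      exact ⟨⟨π (X i), hb⟩, by simp [mul_comm (π (X i)) (π (X j)), h0]⟩
  -- A monomial divided by the power of `X_i` of the same degree is a product of coordinates `X_j /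
  -- X_i`.
  have hfrac : ∀ i ∈ B, ∀ (W : Opens (OpenPt U)), W ≤ nv U (π (X i)) →
      ∀ (m : σ →₀ ℕ) (s : Sec U W), IsFrac s (π (mono m)) (π (X i) ^ m.degree) → Fixes f s := by
    intro i hi W hW m
    induction m using Finsupp.induction_linear with
    | zero =>
      intro s hs
      have : s = 1 := hs.ext IsFrac.one (by simp [mono_zero])
      rw [this]
      exact Fixes.one
    | add k l hk hl =>
      intro s hs
      obtain ⟨t, ht⟩ := exists_isFrac (U := U) (V := W) (hπ.mono_mem_deg k) (hπ.X_pow_mem_deg i _)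
        fun q hq => q.pt.isPrime.compl.pow_mem (mem_nv.1 (hW hq)) _
      obtain ⟨u, hu⟩ := exists_isFrac (U := U) (V := W) (hπ.mono_mem_deg l) (hπ.X_pow_mem_deg i _)
        fun q hq => q.pt.isPrime.compl.pow_mem (mem_nv.1 (hW hq)) _
      have : s = t * u := hs.ext (ht.mul hu) (by
        rw [mono_add, map_mul, map_add, pow_add, mul_comm])
      rw [this]
      exact (hk t ht).mul (hl u hu)
    | single j n =>
      intro s hs
      obtain ⟨t, ht⟩ := exists_isFrac (U := U) (V := nv U (π (X i))) (hπ.X_mem_deg j)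
        (hπ.X_mem_deg i) fun q hq => mem_nv.1 hq
      have : s = (res hW t) ^ n := hs.ext ((ht.res hW).pow n) (by
        rw [Finsupp.degree_single, ← map_X_pow, mul_comm])
      rw [this]
      have h1 := (hcoord i hi j t ht).res hW
      clear this hs
      induction n with
      | zero => rw [pow_zero]; exact Fixes.one
      | succ n ih => rw [pow_succ]; exact ih.mul h1
  have hfrac' : ∀ i ∈ B, ∀ (W : Opens (OpenPt U)), W ≤ nv U (π (X i)) →
      ∀ (a : M) (n : ℕ) (s : Sec U W), a ∈ 𝒜.deg n → IsFrac s a (π (X i) ^ n) → Fixes f s := by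
    intro i hi W hW a n s ha hs
    by_cases h0 : a = 0
    · subst h0
      exact fixes_zero hfg hs
    · rcases hπ.eq_zero_or_mono a with rfl | ⟨m, rfl⟩
      · exact absurd rfl h0
      · rw [← hπ.degree_eq ha h0] at hs
        exact hfrac i hi W hW m s hs
  refine eq_id_of_fixes (TopCat.hom_ext (ContinuousMap.ext hfb)) fun V s q hq hq' => ?_
  obtain ⟨W, iW, n, a, b, hqW, ha, hb, hs⟩ := exists_local_isFrac s q hq
  obtain ⟨i, hi, hiq⟩ := (hU q.pt).1 q.pt_mem
  let W' := W ⊓ nv U (π (X i))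
  have hqW' : q ∈ W' := ⟨hqW, mem_nv.2 hiq⟩
  have hW : W' ≤ V := inf_le_left.trans iW.unop.le
  have hs' : IsFrac (res hW s) a b := hs.map (homOfLE (inf_le_left : W' ≤ W)).op
  have hX : ∀ q ∈ W', π (X i) ^ n ∉ q.pt.ideal := fun q hq =>
    q.pt.isPrime.compl.pow_mem (mem_nv.1 hq.2) _
  obtain ⟨t, ht⟩ := exists_isFrac (U := U) (V := W') ha (hπ.X_pow_mem_deg i n) hX
  obtain ⟨u, hu⟩ := exists_isFrac (U := U) (V := W') hb (hπ.X_pow_mem_deg i n) hX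
  -- For a general denominator `b`, write `a / b` as the quotient of `t = a / X_i ^ n` by `u = b /
  -- X_i ^ n`. Both are fixed, and `u` is a unit near `q`, so it can be cancelled.
  have h1 : res hW s * u = t := (hs'.mul hu).ext ht (by rw [mul_comm a b, mul_assoc, mul_assoc, mul_comm a])
  have hqp : q ∈ pre f W' := (mem_pre hfb).2 hqW'
  have h2 := congrArg (fun t => ev (pull f t) q hqp) h1
  have h3 := congrArg (fun t => ev t q hqW') h1
  simp only [map_mul, ev_mul] at h2 h3
  rw [hfrac' i hi W' inf_le_right a n t ha ht q hqW' hqp,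
    hfrac' i hi W' inf_le_right b n u hb hu q hqW' hqp, ← h3, pull_res, ev_res, ev_res] at h2
  have h4 : IsUnit (ev u q hqW') := by
    obtain ⟨hXq, e⟩ := hu q hqW'
    rw [e, isUnit_mk_iff]
    exact (hs' q hqW').1
  exact h4.mul_right_cancel h2

end Rigidity


/-! ### Order automorphisms of the cliques which meet a given set of vertices -/

section Cliques

variable {σ P : Type*}

/-- The permutations of the vertices which preserve the graph `G` and the set `B`. -/
def relGroup (G : SimpleGraph σ) (B : Set σ) : Subgroup (Equiv.Perm σ) where
  carrier := {g | (∀ i j, G.Adj (g i) (g j) ↔ G.Adj i j) ∧ ∀ i, g i ∈ B ↔ i ∈ B}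
  one_mem' := ⟨fun _ _ => Iff.rfl, fun _ => Iff.rfl⟩
  mul_mem' {g h} hg hh := ⟨fun i j => (hg.1 (h i) (h j)).trans (hh.1 i j),
    fun i => (hg.2 (h i)).trans (hh.2 i)⟩
  inv_mem' {g} hg := ⟨fun i j => by simpa using (hg.1 (g⁻¹ i) (g⁻¹ j)).symm,
    fun i => by simpa using (hg.2 (g⁻¹ i)).symm⟩

/-- Each vertex outside `B` has exactly one neighbour in `B`, and this is also the neighbour of the
adjacent vertices outside `B`. -/
structure IsPendant (G : SimpleGraph σ) (B : Set σ) : Prop where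
  exists_adj : ∀ j ∉ B, ∃ i ∈ B, G.Adj i j
  unique : ∀ j ∉ B, ∀ i ∈ B, ∀ i' ∈ B, G.Adj i j → G.Adj i' j → i = i'
  adj : ∀ j ∉ B, ∀ k ∉ B, G.Adj j k → ∃ i ∈ B, G.Adj i j ∧ G.Adj i k

/-- `S` identifies `P` with the set of the cliques which meet `B`. -/
structure IsCliqueModel (G : SimpleGraph σ) (B : Set σ) (S : P → Set σ) : Prop where
  injective : Function.Injective S
  isClique : ∀ p, G.IsClique (S p)
  exists_mem : ∀ p, ∃ i ∈ B, i ∈ S p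
  surjective : ∀ A : Set σ, G.IsClique A → (∃ i ∈ B, i ∈ A) → ∃ p, S p = A

variable {G : SimpleGraph σ} {B : Set σ} {S : P → Set σ}

/-- Singletons in `B` are the minimal members of the model, so `φ` permutes them. A vertex `j`
outside `B` is no member by itself. It is seen through the pair `{i, j}` with its unique neighbour
`i` in `B`, a clique whose only proper subclique meeting `B` is `{i}`. -/
theorem IsCliqueModel.exists_vertex_map (hS : IsCliqueModel G B S) (hB : IsPendant G B)
    (φ : P ≃ P) (hφ : ∀ p q, S (φ p) ⊆ S (φ q) ↔ S p ⊆ S q) :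
    ∃ f : σ → σ, (∀ i, f i ∈ B ↔ i ∈ B) ∧ (∀ i ∈ B, ∀ p, S p = {i} → S (φ p) = {f i}) ∧
      ∀ j ∉ B, ∀ i ∈ B, G.Adj i j → ∀ p, S p = {i, j} → S (φ p) = {f i, f j} := by
  classical
  have hφ' (p q) : S (φ.symm p) ⊆ S q ↔ S p ⊆ S (φ q) := by rw [← hφ, φ.apply_symm_apply]
  have h1 : ∀ i ∈ B, ∃ i' ∈ B, ∀ p, S p = {i} → S (φ p) = {i'} := by
    intro i hi
    obtain ⟨p, hp⟩ := hS.surjective {i} (by simp) ⟨i, hi, rfl⟩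
    obtain ⟨i', hi', hmem⟩ := hS.exists_mem (φ p)
    refine ⟨i', hi', fun q hq => ?_⟩
    obtain rfl : q = p := hS.injective (hq.trans hp.symm)
    obtain ⟨r, hr⟩ := hS.surjective {i'} (by simp) ⟨i', hi', rfl⟩
    have h2 : S (φ.symm r) ⊆ S q := by
      rw [hφ', hr]
      simpa using hmem
    obtain ⟨c, -, hc⟩ := hS.exists_mem (φ.symm r)
    have h3 : S (φ.symm r) = S q := by
      rw [hp] at h2 ⊢
      exact Set.Nonempty.subset_singleton_iff ⟨c, hc⟩ |>.1 h2
    rw [← hS.injective h3, φ.apply_symm_apply, hr]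
  choose! f hfB hf using h1
  have h2 : ∀ j, j ∉ B → ∃ k, k ∉ B ∧ ∀ i ∈ B, G.Adj i j → ∀ p, S p = {i, j} →
      S (φ p) = {f i, k} := by
    intro j hj
    obtain ⟨i, hi, hij⟩ := hB.exists_adj j hj
    obtain ⟨s, hs⟩ := hS.surjective {i} (by simp) ⟨i, hi, rfl⟩
    obtain ⟨p, hp⟩ := hS.surjective {i, j}
      (by rw [SimpleGraph.isClique_pair]; exact fun _ => hij) ⟨i, hi, by simp⟩
    have hfs := hf i hi s hs
    have hsp : S s ⊆ S p := by rw [hs, hp]; simp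
    have hfi : f i ∈ S (φ p) := (hφ s p).2 hsp (by rw [hfs]; rfl)
    -- The image of `{i, j}` strictly contains the image `{f i}` of `{i}`, hence has a further
    -- vertex.
    obtain ⟨k, hk, hki⟩ : ∃ k ∈ S (φ p), k ≠ f i := by
      by_contra! hcon
      have h3 : S (φ p) = S (φ s) := by
        rw [hfs]
        exact Set.eq_singleton_iff_unique_mem.2 ⟨hfi, hcon⟩
      have h4 := φ.injective (hS.injective h3)
      rw [h4, hs] at hp
      have h5 : j ∈ ({i} : Set σ) := by rw [hp]; simp
      exact hij.ne h5.symm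
    -- Otherwise `{k}` pulls back to a clique inside `{i, j}` that meets `B`, hence contains `i`.
    -- This would force `f i = k`.
    have hkB : k ∉ B := by
      intro hkB
      obtain ⟨r, hr⟩ := hS.surjective {k} (by simp) ⟨k, hkB, rfl⟩
      have h3 : S (φ.symm r) ⊆ S p := by rw [hφ', hr]; simpa using hk
      obtain ⟨c, hcB, hc⟩ := hS.exists_mem (φ.symm r)
      have hci : c = i := by
        have := h3 hc
        rw [hp] at this
        rcases this with h | h
        · exact h
        · exact absurd (h ▸ hcB) hj
      have h4 : S s ⊆ S (φ.symm r) := by rw [hs]; simpa using hci ▸ hc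
      rw [← hφ, φ.apply_symm_apply, hfs, hr] at h4
      exact hki (h4 rfl).symm
    -- The clique `{f i, k}` pulls back to one between `{i}` and `{i, j}` and different from `{i}`,
    -- so to `{i, j}` itself. Hence `φ p` has no third vertex.
    obtain ⟨r, hr⟩ := hS.surjective {f i, k} ((hS.isClique (φ p)).subset (by
      rintro x (rfl | rfl)
      · exact hfi
      · exact hk)) ⟨f i, hfB i hi, by simp⟩
    have h3 : S (φ.symm r) ⊆ S p := by
      rw [hφ', hr]
      rintro x (rfl | rfl)
      · exact hfi
      · exact hk
    have h4 : S s ⊆ S (φ.symm r) := by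
      rw [← hφ, φ.apply_symm_apply, hfs, hr]; simp
    have h5 : j ∈ S (φ.symm r) := by
      by_contra hcon
      have h6 : S (φ.symm r) ⊆ S s := by
        intro x hx
        have := h3 hx
        rw [hp] at this
        rcases this with h | h
        · rw [hs]; exact h
        · exact absurd (h ▸ hx) hcon
      rw [hφ', hr, hfs] at h6
      exact hki (h6 (by simp))
    have h6 : S (φ.symm r) = S p := by
      refine h3.antisymm ?_
      rw [hp]
      rintro x (rfl | rfl)
      · exact h4 (by rw [hs]; rfl)
      · exact h5
    have h7 : r = φ p := by rw [← hS.injective h6, φ.apply_symm_apply]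
    refine ⟨k, hkB, fun i' hi' hij' q hq => ?_⟩
    obtain rfl := hB.unique j hj i hi i' hi' hij hij'
    rw [hS.injective (hq.trans hp.symm), ← h7, hr]
  choose! k hkB hk using h2
  refine ⟨fun i => if i ∈ B then f i else k i, fun i => ?_, fun i hi p hp => ?_,
    fun j hj i hi hij p hp => ?_⟩
  · by_cases hi : i ∈ B
    · simp [hi, hfB i hi]
    · simp [hi, hkB i hi]
  · simpa [hi] using hf i hi p hp
  · simpa [hi, hj] using hk j hj i hi hij p hp

/-- Order automorphisms of the set of cliques which meet `B` are induced by permutations of the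
vertices. -/
theorem IsCliqueModel.exists_perm (hS : IsCliqueModel G B S) (hB : IsPendant G B)
    (φ : P ≃ P) (hφ : ∀ p q, S (φ p) ⊆ S (φ q) ↔ S p ⊆ S q) :
    ∃ g ∈ relGroup G B, ∀ p, S (φ p) = g '' S p := by
  -- Membership in a clique is inclusion of a singleton, for vertices in `B`, or of a pair with a
  -- vertex of the clique in `B`, for the others. Both inclusions are preserved by `φ`.
  have key : ∀ (φ : P ≃ P), (∀ p q, S (φ p) ⊆ S (φ q) ↔ S p ⊆ S q) → ∀ f : σ → σ,
      (∀ i ∈ B, ∀ p, S p = {i} → S (φ p) = {f i}) →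
      (∀ j ∉ B, ∀ i ∈ B, G.Adj i j → ∀ p, S p = {i, j} → S (φ p) = {f i, f j}) →
      ∀ p, ∀ i ∈ S p, f i ∈ S (φ p) := by
    intro φ hφ f h1 h2 p i hi
    by_cases hiB : i ∈ B
    · obtain ⟨s, hs⟩ := hS.surjective {i} (by simp) ⟨i, hiB, rfl⟩
      exact (hφ s p).2 (by rw [hs]; simpa using hi) (by rw [h1 i hiB s hs]; rfl)
    · obtain ⟨b, hb, hbp⟩ := hS.exists_mem p
      have hadj : G.Adj b i := hS.isClique p hbp hi (by rintro rfl; exact hiB hb)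
      obtain ⟨s, hs⟩ := hS.surjective {b, i}
        (by rw [SimpleGraph.isClique_pair]; exact fun _ => hadj) ⟨b, hb, by simp⟩
      refine (hφ s p).2 ?_ (by rw [h2 i hiB b hb hadj s hs]; simp)
      rw [hs]
      rintro x (rfl | rfl)
      · exact hbp
      · exact hi
  have key' : ∀ (φ ψ : P ≃ P) (f f' : σ → σ), (∀ p, ψ (φ p) = p) →
      (∀ i, f i ∈ B ↔ i ∈ B) →
      (∀ i, f' i ∈ B ↔ i ∈ B) →
      (∀ i ∈ B, ∀ p, S p = {i} → S (φ p) = {f i}) →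
      (∀ j ∉ B, ∀ i ∈ B, G.Adj i j → ∀ p, S p = {i, j} → S (φ p) = {f i, f j}) →
      (∀ i ∈ B, ∀ p, S p = {i} → S (ψ p) = {f' i}) →
      (∀ j ∉ B, ∀ i ∈ B, G.Adj i j → ∀ p, S p = {i, j} → S (ψ p) = {f' i, f' j}) →
      ∀ i, f' (f i) = i := by
    intro φ ψ f f' hψφ hfB hfB' h1 h2 h1' h2'
    have hBi : ∀ i ∈ B, f' (f i) = i := by
      intro i hi
      obtain ⟨s, hs⟩ := hS.surjective {i} (by simp) ⟨i, hi, rfl⟩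
      have h3 := h1' (f i) ((hfB i).2 hi) _ (h1 i hi s hs)
      rw [hψφ, hs] at h3
      exact (Set.singleton_injective h3).symm
    intro j
    by_cases hj : j ∈ B
    · exact hBi j hj
    · obtain ⟨i, hi, hij⟩ := hB.exists_adj j hj
      obtain ⟨s, hs⟩ := hS.surjective {i, j}
        (by rw [SimpleGraph.isClique_pair]; exact fun _ => hij) ⟨i, hi, by simp⟩
      have h3 := h2 j hj i hi hij s hs
      have hfi := (hfB i).2 hi
      have hfj : f j ∉ B := fun h => hj ((hfB j).1 h)
      have hadj : G.Adj (f i) (f j) := hS.isClique (φ s) (by rw [h3]; simp) (by rw [h3]; simp)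
        fun h => hfj (h ▸ hfi)
      have h4 := h2' (f j) hfj (f i) hfi hadj _ h3
      rw [hψφ, hs, hBi i hi] at h4
      have h5 : f' (f j) ∈ ({i, j} : Set σ) := by rw [h4]; simp
      rcases h5 with h5 | h5
      · exact absurd ((hfB' _).1 (h5 ▸ hi)) hfj
      · exact h5
  have hφs : ∀ p q, S (φ.symm p) ⊆ S (φ.symm q) ↔ S p ⊆ S q := fun p q => by
    rw [← hφ, φ.apply_symm_apply, φ.apply_symm_apply]
  obtain ⟨f, hfB, h1, h2⟩ := hS.exists_vertex_map hB φ hφ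
  obtain ⟨f', hfB', h1', h2'⟩ := hS.exists_vertex_map hB φ.symm hφs
  have hleft := key' φ φ.symm f f' φ.symm_apply_apply hfB hfB' h1 h2 h1' h2'
  have hright := key' φ.symm φ f' f φ.apply_symm_apply hfB' hfB h1' h2' h1 h2
  have hm := key φ hφ f h1 h2
  have hm' := key φ.symm hφs f' h1' h2'
  have hadj : ∀ (φ : P ≃ P) (f f' : σ → σ), (∀ i, f' (f i) = i) →
      (∀ p, ∀ i ∈ S p, f i ∈ S (φ p)) → ∀ i j, G.Adj i j → G.Adj (f i) (f j) := by
    intro φ f f' hleft hm i j hij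
    obtain ⟨p, hi, hj⟩ : ∃ p, i ∈ S p ∧ j ∈ S p := by
      by_cases h : i ∈ B ∨ j ∈ B
      · obtain ⟨p, hp⟩ := hS.surjective {i, j}
          (by rw [SimpleGraph.isClique_pair]; exact fun _ => hij)
          (by rcases h with h | h; exacts [⟨i, h, by simp⟩, ⟨j, h, by simp⟩])
        exact ⟨p, by simp [hp], by simp [hp]⟩
      · rw [not_or] at h
        -- An edge outside `B` is not in the model, but the triangle with a common neighbour in `B`
        -- is.
        obtain ⟨b, hb, hbi, hbj⟩ := hB.adj i h.1 j h.2 hij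
        obtain ⟨p, hp⟩ := hS.surjective {b, i, j}
          (by
            rw [SimpleGraph.isClique_insert, SimpleGraph.isClique_pair]
            refine ⟨fun _ => hij, ?_⟩
            rintro x (rfl | rfl) -
            · exact hbi
            · exact hbj) ⟨b, hb, by simp⟩
        exact ⟨p, by simp [hp], by simp [hp]⟩
    refine hS.isClique (φ p) (hm p i hi) (hm p j hj) fun h => hij.ne ?_
    rw [← hleft i, ← hleft j, h]
  refine ⟨⟨f, f', hleft, hright⟩, ⟨fun i j => ⟨fun h => ?_, hadj φ f f' hleft hm i j⟩, hfB⟩,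
    fun p => ?_⟩
  · have := hadj φ.symm f' f hright hm' _ _ h
    change G.Adj (f' (f i)) (f' (f j)) at this
    rwa [hleft, hleft] at this
  · ext x
    constructor
    · intro hx
      have := hm' _ x hx
      rw [φ.symm_apply_apply] at this
      exact ⟨f' x, this, hright x⟩
    · rintro ⟨y, hy, rfl⟩
      exact hm p y hy

theorem IsCliqueModel.perm_unique (hS : IsCliqueModel G B S) (hB : IsPendant G B)
    {g h : Equiv.Perm σ} (hgh : ∀ p, g '' S p = h '' S p) : g = h := by
  have h1 : ∀ i ∈ B, g i = h i := by
    intro i hi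
    obtain ⟨s, hs⟩ := hS.surjective {i} (by simp) ⟨i, hi, rfl⟩
    have := hgh s
    rw [hs, Set.image_singleton, Set.image_singleton] at this
    exact Set.singleton_injective this
  ext j
  by_cases hj : j ∈ B
  · exact h1 j hj
  · obtain ⟨i, hi, hij⟩ := hB.exists_adj j hj
    obtain ⟨s, hs⟩ := hS.surjective {i, j}
      (by rw [SimpleGraph.isClique_pair]; exact fun _ => hij) ⟨i, hi, by simp⟩
    have h2 := hgh s
    rw [hs, Set.image_pair, Set.image_pair, h1 i hi] at h2
    have h3 : g j ∈ ({h i, h j} : Set σ) := by rw [← h2]; simp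
    rcases h3 with h3 | h3
    · rw [← h1 i hi] at h3
      exact absurd (g.injective h3).symm hij.ne
    · exact h3

end Cliques


/-! ### The automorphism group of an open subspace of the scheme of a graph -/

section Relabel

variable {σ : Type u}

/-- The relabelling of the variables. -/
def relabelHom (g : Equiv.Perm σ) : Poly σ →*₀ Poly σ :=
  WithZero.map' (AddMonoidHom.toMultiplicative
    ((Finsupp.domCongr g : (σ →₀ ℕ) ≃+ (σ →₀ ℕ)) : (σ →₀ ℕ) →+ (σ →₀ ℕ)))

theorem relabelHom_mono (g : Equiv.Perm σ) (m : σ →₀ ℕ) :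
    relabelHom g (mono m) = mono (m.equivMapDomain g) := rfl

theorem relabelHom_relabelHom {g h : Equiv.Perm σ} (hgh : ∀ i, g (h i) = i) (a : Poly σ) :
    relabelHom g (relabelHom h a) = a := by
  rcases eq_zero_or_mono a with rfl | ⟨m, rfl⟩
  · rw [map_zero, map_zero]
  · rw [relabelHom_mono, relabelHom_mono, ← Finsupp.equivMapDomain_trans,
      show h.trans g = Equiv.refl σ from Equiv.ext hgh, Finsupp.equivMapDomain_refl]

/-- The relabelling of the variables, as an automorphism. -/
def relabel (g : Equiv.Perm σ) : Poly σ ≃* Poly σ where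
  toFun := relabelHom g
  invFun := relabelHom g.symm
  left_inv := relabelHom_relabelHom g.symm_apply_apply
  right_inv := relabelHom_relabelHom g.apply_symm_apply
  map_mul' := map_mul _

theorem relabel_mono (g : Equiv.Perm σ) (m : σ →₀ ℕ) :
    relabel g (mono m) = mono (m.equivMapDomain g) := rfl

theorem relabel_X (g : Equiv.Perm σ) (i : σ) : relabel g (X i) = X (g i) := by
  rw [← mono_single, relabel_mono, Finsupp.equivMapDomain_single, mono_single]

theorem exists_mulEquiv_of_surjective {A M : Type*} [Monoid A] [Monoid M] (π : A →* M)
    (hπ : Function.Surjective π) (τ : A ≃* A) (h : ∀ a b, π (τ a) = π (τ b) ↔ π a = π b) :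
    ∃ η : M ≃* M, ∀ a, η (π a) = π (τ a) := by
  have key (a : A) : π (τ (Function.surjInv hπ (π a))) = π (τ a) :=
    (h _ _).2 (Function.surjInv_eq hπ _)
  let η : M →* M :=
    { toFun := fun x => π (τ (Function.surjInv hπ x))
      map_one' := by simpa using key 1
      map_mul' := fun x y => by
        obtain ⟨a, rfl⟩ := hπ x
        obtain ⟨b, rfl⟩ := hπ y
        rw [← map_mul, key, key, key, map_mul, map_mul] }
  refine ⟨MulEquiv.ofBijective η ⟨fun x y hxy => ?_, fun x => ?_⟩, key⟩
  · obtain ⟨a, rfl⟩ := hπ x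
    obtain ⟨b, rfl⟩ := hπ y
    exact (h a b).1 ((key a).symm.trans (hxy.trans (key b)))
  · obtain ⟨a, rfl⟩ := hπ x
    exact ⟨π (τ.symm a), (key _).trans (by rw [τ.apply_symm_apply])⟩

/-! ### Permutations of the vertices and automorphisms of the scheme. -/

variable {M : Type u} [CommMonoidWithZero M] {𝒜 : Grading M} {G : SimpleGraph σ}
  {π : Poly σ →*₀ M} (hπ : IsCoordinate 𝒜 G π) {U : Opens (Proj 𝒜).toSheafedSpace} {B : Set σ}

open IsCoordinate

include hπ

/-- Relabelling by a graph automorphism preserves non-edges, hence the monomials that are zero in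
`M`, and it preserves total degree. -/
theorem exists_relabel (g : Equiv.Perm σ) (hg : ∀ i j, G.Adj (g i) (g j) ↔ G.Adj i j) :
    ∃ η : M ≃* M, 𝒜.Preserves η ∧ ∀ i, η (π (X i)) = π (X (g i)) := by
  have hzero (m : σ →₀ ℕ) : π (mono (m.equivMapDomain g)) = 0 ↔ π (mono m) = 0 := by
    rw [hπ.mono_eq_zero_iff, hπ.mono_eq_zero_iff]
    constructor
    · rintro ⟨i, j, hij, hadj, hi, hj⟩
      refine ⟨g.symm i, g.symm j, fun h => hij (g.symm.injective h), ?_, hi, hj⟩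
      rwa [← hg, g.apply_symm_apply, g.apply_symm_apply]
    · rintro ⟨i, j, hij, hadj, hi, hj⟩
      exact ⟨g i, g j, fun h => hij (g.injective h), fun h => hadj ((hg i j).1 h),
        by simpa using hi, by simpa using hj⟩
  have hz (a : Poly σ) : π (relabel g a) = 0 ↔ π a = 0 := by
    rcases FOne.eq_zero_or_mono a with rfl | ⟨m, rfl⟩
    · rw [map_zero]
    · exact hzero m
  obtain ⟨η, hη⟩ := exists_mulEquiv_of_surjective (π : Poly σ →* M) hπ.surjective (relabel g) <| by
    intro a b
    change π (relabel g a) = π (relabel g b) ↔ π a = π b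
    constructor
    · intro h
      by_cases h0 : π a = 0
      · rw [h0, eq_comm, ← hz, ← h, hz, h0]
      · rw [(relabel g).injective (hπ.eq_of_eq _ _ h (by rwa [Ne, hz]))]
    · intro h
      by_cases h0 : π a = 0
      · rw [(hz a).2 h0, eq_comm, hz, ← h, h0]
      · rw [hπ.eq_of_eq _ _ h h0]
  refine ⟨η, fun n x => ?_, fun i => (hη (X i)).trans (congrArg π (relabel_X g i))⟩
  by_cases h0 : x = 0
  · rw [h0, map_zero]
  · rcases hπ.eq_zero_or_mono x with rfl | ⟨m, rfl⟩
    · exact absurd rfl h0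
    · have h1 : η (π (mono m)) = π (mono (m.equivMapDomain g)) := hη (mono m)
      have h2 : (m.equivMapDomain g).degree = m.degree := by
        rw [Finsupp.equivMapDomain_eq_mapDomain, Finsupp.degree_mapDomain]
      rw [h1]
      constructor
      · intro h
        rw [← hπ.degree_eq h (by rwa [Ne, hzero]), h2]
        exact hπ.mono_mem_deg m
      · intro h
        rw [← hπ.degree_eq h h0, ← h2]
        exact hπ.mono_mem_deg _

/-- The points of the union of the charts of the vertices in `B` are the cliques which meet `B`. -/
theorem isCliqueModel_supp (hU : ∀ p : ProjPt 𝒜, p ∈ U ↔ ∃ i ∈ B, i ∈ supp π p) :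
    IsCliqueModel G B (fun q : OpenPt U => supp π q.pt) where
  injective _ _ h := OpenPt.pt_injective (hπ.supp_injective h)
  isClique q := hπ.isClique_supp q.pt
  exists_mem q := (hU _).1 q.pt_mem
  surjective A hA := by
    rintro ⟨i, hi, hiA⟩
    obtain ⟨p, hp⟩ := hπ.exists_supp_eq hA ⟨i, hiA⟩
    exact ⟨⟨p, (hU p).2 ⟨i, hi, by rwa [hp]⟩⟩, hp⟩

theorem exists_aut_of_mem_relGroup (hU : ∀ p : ProjPt 𝒜, p ∈ U ↔ ∃ i ∈ B, i ∈ supp π p)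
    {g : Equiv.Perm σ} (hg : g ∈ relGroup G B) :
    ∃ e : Aut ((Proj 𝒜).restrict U), ∀ q : OpenPt U,
      supp π (OpenPt.pt (e.hom.hom.hom.base q : OpenPt U)) = g '' supp π q.pt := by
  have hg' := (relGroup G B).inv_mem hg
  -- The inverse compensates for contravariance: `X_i` is nonzero at the preimage of a prime exactly
  -- if `X_(g⁻¹ i)` is nonzero at the prime, so supports move by `g`.
  obtain ⟨η, hη, hηX⟩ := exists_relabel hπ g⁻¹ hg'.1
  have hs (p : ProjPt 𝒜) : supp π (p.comap η hη) = g '' supp π p := by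
    ext i
    have h1 : i ∈ supp π (p.comap η hη) ↔ g⁻¹ i ∈ supp π p := by
      change η (π (X i)) ∉ p.ideal ↔ π (X (g⁻¹ i)) ∉ p.ideal
      rw [hηX]
    rw [h1]
    constructor
    · exact fun h => ⟨_, h, g.apply_symm_apply i⟩
    · rintro ⟨j, hj, rfl⟩
      exact (congrArg (· ∈ supp π p) (g.symm_apply_apply j)).mpr hj
  obtain ⟨e, he⟩ := MonoidalSpace.exists_restrict_iso (projIso η hη) U fun (p : ProjPt 𝒜) => by
    refine (hU (p.comap η hη)).trans (Iff.trans ?_ (hU p).symm)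
    rw [hs]
    constructor
    · rintro ⟨_, hi, i, hip, rfl⟩
      exact ⟨i, (hg.2 i).1 hi, hip⟩
    · rintro ⟨i, hi, hip⟩
      exact ⟨g i, (hg.2 i).2 hi, i, hip, rfl⟩
  refine ⟨e, fun q => ?_⟩
  rw [← hs]
  exact congrArg (supp π) (he q)

/-- The automorphism group of the union of the charts of the vertices in `B`. -/
theorem nonempty_mulEquiv_aut (hU : ∀ p : ProjPt 𝒜, p ∈ U ↔ ∃ i ∈ B, i ∈ supp π p)
    (hB : IsPendant G B) : Nonempty (relGroup G B ≃* Aut ((Proj 𝒜).restrict U)) := by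
  have hS := isCliqueModel_supp hπ hU
  have h1 (e : Aut ((Proj 𝒜).restrict U)) : ∃ g ∈ relGroup G B, ∀ q : OpenPt U,
      supp π (OpenPt.pt (e.hom.hom.hom.base q : OpenPt U)) = g '' supp π q.pt := by
    refine hS.exists_perm hB (MonoidalSpace.autToPerm _ e) fun p q => ?_
    rw [← hπ.ideal_le_iff, ← hπ.ideal_le_iff, ← OpenPt.specializes_iff, ← OpenPt.specializes_iff]
    exact (MonoidalSpace.baseHomeo e).isInducing.specializes_iff
  choose F hF hFs using h1
  -- The inducing permutation is unique, so the choice `F` is multiplicative.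
  let Ψ : Aut ((Proj 𝒜).restrict U) →* relGroup G B := MonoidHom.mk' (fun e => ⟨F e, hF e⟩) <| by
    intro e e'
    refine Subtype.ext (hS.perm_unique hB fun q => ?_)
    change F (e * e') '' supp π q.pt = (F e * F e') '' supp π q.pt
    rw [← hFs, Equiv.Perm.coe_mul, Set.image_comp, ← hFs, ← hFs]
    rfl
  refine ⟨(MulEquiv.ofBijective Ψ ⟨?_, fun g => ?_⟩).symm⟩
  · rw [injective_iff_map_eq_one]
    intro e he
    have hFe : F e = 1 := congrArg Subtype.val he
    have hbase (q : OpenPt U) : e.hom.hom.hom.base q = q := by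
      refine hS.injective ((hFs e q).trans ?_)
      rw [hFe]
      exact Set.image_id _
    have hbase' (q : OpenPt U) : e.inv.hom.hom.base q = q := by
      have := (MonoidalSpace.baseHomeo e).left_inv q
      exact (congrArg e.inv.hom.hom.base (hbase q)).symm.trans this
    have h2 := eq_id_of_base hπ B hU (f := e.hom.hom) (g := e.inv.hom) e.hom.isLocal e.inv.isLocal
      (MonoidalSpace.inv_hom_hom e) (MonoidalSpace.hom_inv_hom e) hbase hbase'
    exact Iso.ext (MonoidalSpace.Hom.ext h2)
  · obtain ⟨e, he⟩ := exists_aut_of_mem_relGroup hπ hU g.2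
    exact ⟨e, Subtype.ext (hS.perm_unique hB fun q => (hFs e q).symm.trans (he q))⟩

omit hπ in
theorem mem_basicOpens_span {T : Set M} {p : ProjPt 𝒜} :
    p ∈ basicOpens 𝒜 (MonoidIdeal.span T) ↔ ∃ t ∈ T, t ∉ p.ideal := by
  rw [← not_iff_not]
  push Not
  refine not_not.trans ⟨fun h t ht => h t (Or.inr ⟨t, ht, dvd_rfl⟩), ?_⟩
  rintro h x (rfl | ⟨t, ht, c, rfl⟩)
  · exact p.ideal.zero_mem
  · rw [mul_comm]
    exact p.ideal.mul_mem _ _ (h t ht)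

end Relabel

end FOne

/-! ### The completion of a loose graph. -/

namespace LooseGraph

open FOne

variable {V : Type u} {E : Type v} (Γ : LooseGraph V E)

/-- The vertices of `Γ` among those of `ℙ(Γ)`. -/
def oldVerts : Set Γ.PVert := Set.range Sum.inl

variable {Γ}

theorem inl_mem_oldVerts (w : V) : (Sum.inl w : Γ.PVert) ∈ Γ.oldVerts := ⟨w, rfl⟩

theorem inr_notMem_oldVerts (l : {e : E // Γ.IsLoose e}) :
    (Sum.inr l : Γ.PVert) ∉ Γ.oldVerts := by
  rintro ⟨w, hw⟩
  cases hw

theorem completion_adj_inl_inl {w w' : V} :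
    Γ.completion.Adj (Sum.inl w) (Sum.inl w') ↔ w ≠ w' ∧ ∃ e, Γ.Inc w e ∧ Γ.Inc w' e := by
  constructor
  · rintro ⟨h, e, hw, hw'⟩
    exact ⟨fun h' => h (congrArg _ h'), e, hw, hw'⟩
  · rintro ⟨h, e, hw, hw'⟩
    exact ⟨fun h' => h (Sum.inl_injective h'), e, hw, hw'⟩

theorem completion_adj_inl_inr {w : V} {l : {e : E // Γ.IsLoose e}} :
    Γ.completion.Adj (Sum.inl w) (Sum.inr l) ↔ Γ.Inc w l.1 := by
  constructor
  · rintro ⟨-, e, hw, rfl⟩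
    exact hw
  · exact fun h => ⟨Sum.inl_ne_inr, l.1, h, rfl⟩

theorem not_completion_adj_inr_inr {l l' : {e : E // Γ.IsLoose e}} :
    ¬ Γ.completion.Adj (Sum.inr l) (Sum.inr l') := by
  rintro ⟨h, e, hl, hl'⟩
  exact h (congrArg _ (Subtype.ext (Eq.trans hl (Eq.symm hl'))))

theorem IsLoose.exists_unique {e : E} (h : Γ.IsLoose e) : ∃ w, ∀ w', Γ.Inc w' e ↔ w' = w := by
  obtain ⟨w, hw⟩ := Set.encard_eq_one.1 h
  exact ⟨w, fun w' => Set.ext_iff.1 hw w'⟩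

/-- The only neighbour of a new vertex is the one end of its loose edge. Two new vertices lie on
different edges and are never adjacent. -/
theorem isPendant_completion : IsPendant Γ.completion Γ.oldVerts where
  exists_adj := by
    rintro (w | l) hj
    · exact absurd (inl_mem_oldVerts w) hj
    · obtain ⟨w, hw⟩ := l.2.exists_unique
      exact ⟨_, inl_mem_oldVerts w, completion_adj_inl_inr.2 ((hw w).2 rfl)⟩
  unique := by
    rintro (w | l) hj _ ⟨x, rfl⟩ _ ⟨y, rfl⟩ hx hy
    · exact absurd (inl_mem_oldVerts w) hj
    · obtain ⟨w, hw⟩ := l.2.exists_unique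
      rw [(hw x).1 (completion_adj_inl_inr.1 hx), (hw y).1 (completion_adj_inl_inr.1 hy)]
  adj := by
    rintro (w | l) hj (w' | l') hk h
    · exact absurd (inl_mem_oldVerts w) hj
    · exact absurd (inl_mem_oldVerts w) hj
    · exact absurd (inl_mem_oldVerts w') hk
    · exact absurd h not_completion_adj_inr_inr

/-! ### Automorphisms of the loose graph and of its completion -/

variable (hE : ∀ e : E, ∃ w : V, Γ.Inc w e)

include hE

theorem exists_pair_of_not_isLoose {e : E} (h : ¬ Γ.IsLoose e) :
    ∃ w w', w ≠ w' ∧ ∀ x, Γ.Inc x e ↔ x = w ∨ x = w' := by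
  have h0 : {w | Γ.Inc w e}.encard ≠ 0 := Set.encard_ne_zero.2 (hE e)
  have h2 : {w | Γ.Inc w e}.encard = 2 := by
    have h3 := Γ.encard_le_two e
    have h4 : {w | Γ.Inc w e}.encard ≠ 1 := h
    generalize {w | Γ.Inc w e}.encard = n at *
    cases n with
    | top => exact absurd h3 (by decide)
    | coe n =>
      norm_cast at *
      omega
  obtain ⟨w, w', hne, hw⟩ := Set.encard_eq_two.1 h2
  exact ⟨w, w', hne, fun x => Set.ext_iff.1 hw x⟩

/-- By `hE`, an edge that is not loose has two ends, and these determine it. For loose edges this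
fails, as many can share a vertex; there the new vertices carry the information. -/
theorem eq_of_inc_iff {e e' : E} (h : ¬ Γ.IsLoose e) (he : ∀ w, Γ.Inc w e' ↔ Γ.Inc w e) :
    e' = e := by
  obtain ⟨w, w', hne, hw⟩ := exists_pair_of_not_isLoose hE h
  have h1 := (hw w).2 (Or.inl rfl)
  have h2 := (hw w').2 (Or.inr rfl)
  exact Γ.edge_unique w w' _ _ hne ((he w).2 h1) ((he w').2 h2) h1 h2

omit hE in
theorem isLoose_map_iff {g : Equiv.Perm V × Equiv.Perm E} (hg : g ∈ Γ.autGroup) (e : E) :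
    Γ.IsLoose (g.2 e) ↔ Γ.IsLoose e := by
  have h1 : {w | Γ.Inc w (g.2 e)} = g.1 '' {w | Γ.Inc w e} := by
    ext w
    constructor
    · intro hw
      refine ⟨g.1.symm w, (hg _ _).1 ?_, g.1.apply_symm_apply w⟩
      rw [g.1.apply_symm_apply]
      exact hw
    · rintro ⟨x, hx, rfl⟩
      exact (hg _ _).2 hx
  rw [IsLoose, h1, g.1.injective.encard_image, IsLoose]

omit hE in
/-- The action of the automorphism group of `Γ` on the vertices of `ℙ(Γ)`. -/
def autToRelGroup (Γ : LooseGraph V E) : Γ.autGroup →* relGroup Γ.completion Γ.oldVerts where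
  toFun g := ⟨Equiv.sumCongr g.1.1 (g.1.2.subtypePerm (isLoose_map_iff g.2)), by
    constructor
    · have key : ∀ x e, Γ.PInc (Equiv.sumCongr g.1.1 (g.1.2.subtypePerm (isLoose_map_iff g.2)) x)
          (g.1.2 e) ↔ Γ.PInc x e := by
        rintro (w | l) e
        · exact g.2 w e
        · exact g.1.2.injective.eq_iff
      intro x y
      constructor
      · rintro ⟨hxy, e, hx, hy⟩
        obtain ⟨e, rfl⟩ := g.1.2.surjective e
        exact ⟨fun h => hxy (congrArg _ h), e, (key _ _).1 hx, (key _ _).1 hy⟩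
      · rintro ⟨hxy, e, hx, hy⟩
        exact ⟨fun h => hxy (Equiv.injective _ h), g.1.2 e, (key _ _).2 hx, (key _ _).2 hy⟩
    · rintro (w | l)
      · exact ⟨fun _ => inl_mem_oldVerts w, fun _ => inl_mem_oldVerts _⟩
      · exact ⟨fun h => absurd h (inr_notMem_oldVerts _),
          fun h => absurd h (inr_notMem_oldVerts _)⟩⟩
  map_one' := by
    refine Subtype.ext (Equiv.ext ?_)
    rintro (w | l) <;> rfl
  map_mul' g h := by
    refine Subtype.ext (Equiv.ext ?_)
    rintro (w | l) <;> rfl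

theorem autToRelGroup_injective : Function.Injective (autToRelGroup Γ) := by
  rw [injective_iff_map_eq_one]
  rintro ⟨⟨g, h⟩, hgh⟩ h1
  have h2 (x : Γ.PVert) :
      Equiv.sumCongr g (h.subtypePerm (isLoose_map_iff hgh)) x = x :=
    Equiv.congr_fun (congrArg Subtype.val h1) x
  have hg (w : V) : g w = w := Sum.inl_injective (h2 (Sum.inl w))
  refine Subtype.ext (Prod.ext (Equiv.ext hg) (Equiv.ext fun e => ?_))
  by_cases he : Γ.IsLoose e
  · exact congrArg Subtype.val (Sum.inr_injective (h2 (Sum.inr ⟨e, he⟩)))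
  · refine eq_of_inc_iff hE he fun w => ?_
    have := hgh w e
    change Γ.Inc (g w) (h e) ↔ _ at this
    rwa [hg] at this

omit hE in
theorem exists_sum_maps {γ : Equiv.Perm Γ.PVert} (hγ : ∀ i, γ i ∈ Γ.oldVerts ↔ i ∈ Γ.oldVerts) :
    ∃ (g : V → V) (h : {e : E // Γ.IsLoose e} → {e : E // Γ.IsLoose e}),
      (∀ w, γ (Sum.inl w) = Sum.inl (g w)) ∧ ∀ l, γ (Sum.inr l) = Sum.inr (h l) := by
  have h1 (w : V) : ∃ w', γ (Sum.inl w) = Sum.inl w' := by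
    obtain ⟨w', h⟩ := (hγ _).2 (inl_mem_oldVerts w)
    exact ⟨w', h.symm⟩
  have h2 (l : {e : E // Γ.IsLoose e}) : ∃ l', γ (Sum.inr l) = Sum.inr l' := by
    rcases h : γ (Sum.inr l) with w | l'
    · exact absurd ((hγ _).1 (h ▸ inl_mem_oldVerts w)) (inr_notMem_oldVerts l)
    · exact ⟨l', rfl⟩
  choose g hg using h1
  choose h hh using h2
  exact ⟨g, h, hg, hh⟩

theorem exists_edge_map {γ : Equiv.Perm Γ.PVert} (hγ : γ ∈ relGroup Γ.completion Γ.oldVerts)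
    {g : V → V} {h : {e : E // Γ.IsLoose e} → {e : E // Γ.IsLoose e}}
    (hg : ∀ w, γ (Sum.inl w) = Sum.inl (g w)) (hh : ∀ l, γ (Sum.inr l) = Sum.inr (h l)) :
    ∃ k : E → E, (∀ w e, Γ.Inc (g w) (k e) ↔ Γ.Inc w e) ∧ ∀ l, k l.1 = (h l).1 := by
  have hginj : Function.Injective g := fun w w' hw =>
    Sum.inl_injective (γ.injective (by rw [hg, hg, hw]))
  have h1 (e : E) : ∃ e', (∀ w, Γ.Inc (g w) e' ↔ Γ.Inc w e) ∧
      ∀ he : Γ.IsLoose e, e' = (h ⟨e, he⟩).1 := by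
    by_cases he : Γ.IsLoose e
    · refine ⟨(h ⟨e, he⟩).1, fun w => ?_, fun _ => rfl⟩
      have := hγ.1 (Sum.inl w) (Sum.inr ⟨e, he⟩)
      rwa [hg, hh, completion_adj_inl_inr, completion_adj_inl_inr] at this
    · obtain ⟨w, w', hne, hw⟩ := exists_pair_of_not_isLoose hE he
      have h2 := (hγ.1 (Sum.inl w) (Sum.inl w')).2 (completion_adj_inl_inl.2
        ⟨hne, e, (hw w).2 (Or.inl rfl), (hw w').2 (Or.inr rfl)⟩)
      rw [hg, hg, completion_adj_inl_inl] at h2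
      obtain ⟨hne', e', he1, he2⟩ := h2
      refine ⟨e', fun x => ?_, fun h => absurd h he⟩
      rw [hw]
      constructor
      · intro hx
        by_contra! hcon
        -- A further end `g x` would give `e'` three distinct ends.
        have h3 : ({g w, g w', g x} : Set V).encard ≤ 2 := by
          refine le_trans (Set.encard_le_encard ?_) (Γ.encard_le_two e')
          rintro y (rfl | rfl | rfl)
          exacts [he1, he2, hx]
        rw [Set.encard_eq_three.2 ⟨g w, g w', g x, hne', fun h => hcon.1 (hginj h).symm,
          fun h => hcon.2 (hginj h).symm, rfl⟩] at h3
        exact absurd h3 (by decide)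
      · rintro (rfl | rfl)
        exacts [he1, he2]
  choose k hk hk' using h1
  exact ⟨k, fun w e => hk e w, fun l => hk' l.1 l.2⟩

theorem autToRelGroup_surjective : Function.Surjective (autToRelGroup Γ) := by
  rintro ⟨γ, hγ⟩
  have hγ' := (relGroup Γ.completion Γ.oldVerts).inv_mem hγ
  obtain ⟨g, h, hg, hh⟩ := exists_sum_maps hγ.2
  obtain ⟨g', h', hg', hh'⟩ := exists_sum_maps hγ'.2
  obtain ⟨k, hk, hkl⟩ := exists_edge_map hE hγ hg hh
  obtain ⟨k', hk', hkl'⟩ := exists_edge_map hE hγ' hg' hh'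
  have hgg (w : V) : g' (g w) = w := Sum.inl_injective <| by
    rw [← hg', ← hg]; exact γ.symm_apply_apply _
  have hgg' (w : V) : g (g' w) = w := Sum.inl_injective <| by
    rw [← hg, ← hg']; exact γ.apply_symm_apply _
  have hhh (l) : h' (h l) = l := Sum.inr_injective <| by
    rw [← hh', ← hh]; exact γ.symm_apply_apply _
  have hhh' (l) : h (h' l) = l := Sum.inr_injective <| by
    rw [← hh, ← hh']; exact γ.apply_symm_apply _
  have hkk (e : E) : k' (k e) = e := by
    by_cases he : Γ.IsLoose e
    · rw [hkl ⟨e, he⟩, hkl', hhh]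
    · refine eq_of_inc_iff hE he fun w => ?_
      rw [← hk w e, ← hk' (g w), hgg]
  have hkk' (e : E) : k (k' e) = e := by
    by_cases he : Γ.IsLoose e
    · rw [hkl' ⟨e, he⟩, hkl, hhh']
    · refine eq_of_inc_iff hE he fun w => ?_
      rw [← hk' w e, ← hk (g' w), hgg']
  refine ⟨⟨⟨⟨g, g', hgg, hgg'⟩, ⟨k, k', hkk, hkk'⟩⟩, hk⟩, Subtype.ext (Equiv.ext ?_)⟩
  rintro (w | l)
  · exact (hg w).symm
  · exact (congrArg Sum.inr (Subtype.ext (hkl l))).trans (hh l).symm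

/-- The automorphisms of `Γ` are the automorphisms of its completion which preserve the set of new
vertices. -/
def autEquivRelGroup : Γ.autGroup ≃* relGroup Γ.completion Γ.oldVerts :=
  MulEquiv.ofBijective (autToRelGroup Γ) ⟨autToRelGroup_injective hE, autToRelGroup_surjective hE⟩

/-! ### The three types -/

theorem exists_isLoose_of_not_isTypeI (h : ¬ Γ.IsTypeI) : ∃ e, Γ.IsLoose e := by
  by_contra! hcon
  refine h fun e => ?_
  obtain ⟨w, w', hne, hw⟩ := exists_pair_of_not_isLoose hE (hcon e)
  exact Set.encard_eq_two.2 ⟨w, w', hne, Set.ext hw⟩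

/-- In type II every old vertex is adjacent to every new one. The new vertex of a loose edge has
only one neighbour, so there is only one old vertex. -/
theorem exists_unique_vertex_of_isTypeII (h : ¬ Γ.IsTypeI) (h' : Γ.IsTypeII) :
    ∃ w : V, ∀ w', w' = w := by
  obtain ⟨e, he⟩ := exists_isLoose_of_not_isTypeI hE h
  obtain ⟨w, hw⟩ := he.exists_unique
  refine ⟨w, fun w' => (hw w').1 ?_⟩
  by_contra hcon
  obtain ⟨-, -, ⟨l, hl⟩, -⟩ := h' (Sum.inl w') (Sum.inr ⟨e, he⟩) Sum.inl_ne_inr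
    fun hadj => hcon (completion_adj_inl_inr.1 hadj)
  cases hl

omit hE in
theorem completion_adj_iff_of_isTypeII (h' : Γ.IsTypeII) {x y : Γ.PVert} :
    Γ.completion.Adj x y ↔ x ≠ y ∧ (x ∈ Γ.oldVerts ∨ y ∈ Γ.oldVerts) := by
  constructor
  · intro h
    refine ⟨h.ne, ?_⟩
    rcases x with w | l
    · exact Or.inl (inl_mem_oldVerts w)
    · rcases y with w | l'
      · exact Or.inr (inl_mem_oldVerts w)
      · exact absurd h not_completion_adj_inr_inr
  · rintro ⟨hne, h⟩
    by_contra hcon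
    obtain ⟨-, -, ⟨l, rfl⟩, ⟨l', rfl⟩⟩ := h' x y hne hcon
    rcases h with h | h <;> exact inr_notMem_oldVerts _ h

theorem isPendant_top_of_isTypeII (h : ¬ Γ.IsTypeI) (h' : Γ.IsTypeII) :
    IsPendant (⊤ : SimpleGraph Γ.PVert) Γ.oldVerts := by
  obtain ⟨w, hw⟩ := exists_unique_vertex_of_isTypeII hE h h'
  have hne : ∀ j ∉ Γ.oldVerts, (⊤ : SimpleGraph Γ.PVert).Adj (Sum.inl w) j := by
    intro j hj
    rw [SimpleGraph.top_adj]
    rintro rfl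
    exact hj (inl_mem_oldVerts w)
  refine ⟨fun j hj => ⟨_, inl_mem_oldVerts w, hne j hj⟩, ?_,
    fun j hj k hk _ => ⟨_, inl_mem_oldVerts w, hne j hj, hne k hk⟩⟩
  rintro j - _ ⟨x, rfl⟩ _ ⟨y, rfl⟩ - -
  rw [hw x, hw y]

omit hE in
-- In type II, adjacency in the completion depends only on which vertices are old, so both groups
-- consist of all permutations preserving the old vertices.
theorem relGroup_completion_of_isTypeII (h' : Γ.IsTypeII) :
    relGroup Γ.completion Γ.oldVerts = relGroup (⊤ : SimpleGraph Γ.PVert) Γ.oldVerts := by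
  ext g
  constructor
  · rintro ⟨-, h⟩
    exact ⟨fun i j => by rw [SimpleGraph.top_adj, SimpleGraph.top_adj, g.injective.ne_iff], h⟩
  · rintro ⟨-, h⟩
    refine ⟨fun i j => ?_, h⟩
    rw [completion_adj_iff_of_isTypeII h', completion_adj_iff_of_isTypeII h', h, h,
      g.injective.ne_iff]

theorem nonempty_autGroup_mulEquiv_aut : Nonempty (Γ.autGroup ≃* Aut Γ.S) := by
  let e₀ := autEquivRelGroup hE
  by_cases hI : Γ.IsTypeI
  · rw [show Γ.S = _ from if_pos hI]
    -- A graph has no loose edges, so all vertices are old and their charts cover `Proj`.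
    have hU (p : ProjPt (graphGrading Γ.completion)) :
        p ∈ (⊤ : Opens (Proj (graphGrading Γ.completion)).toSheafedSpace) ↔
          ∃ i ∈ Γ.oldVerts, i ∈ IsCoordinate.supp (quotientHom Γ.completion) p := by
      refine ⟨fun _ => ?_, fun _ => trivial⟩
      obtain ⟨x, hx⟩ := (isCoordinate_quotientHom Γ.completion).supp_nonempty p
      rcases x with w | l
      · exact ⟨_, inl_mem_oldVerts w, hx⟩
      · exact absurd (l.2.symm.trans (hI l.1)) (by decide)
    obtain ⟨e₁⟩ := nonempty_mulEquiv_aut (isCoordinate_quotientHom Γ.completion) hU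
      isPendant_completion
    exact ⟨(e₀.trans e₁).trans (Aut.autMulEquivOfIso (MonoidalSpace.restrictTopIso _))⟩
  by_cases hII : Γ.IsTypeII
  · rw [show Γ.S = _ from (if_neg hI).trans (if_pos hII)]
    -- The generators `X_i` of the ideal are the old variables. A generator `X_x * X_y` comes from
    -- an edge of the completion, which has an old end, so it adds no points to the open set.
    have hU (p : ProjPt (polyGrading Γ.PVert)) :
        p ∈ basicOpens (polyGrading Γ.PVert) (subgraphIdeal Γ.complement) ↔
          ∃ i ∈ Γ.oldVerts, i ∈ IsCoordinate.supp (MonoidWithZeroHom.id (FOne.Poly Γ.PVert)) p := by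
      rw [subgraphIdeal, mem_basicOpens_span]
      constructor
      · rintro ⟨_, ⟨x, hx, rfl⟩ | ⟨x, y, hne, hadj, rfl⟩, ht⟩
        · rcases x with w | l
          · exact ⟨_, inl_mem_oldVerts w, ht⟩
          · exact absurd ⟨l, rfl⟩ hx
        · have h1 : Γ.completion.Adj x y := by
            by_contra hcon
            exact hadj (hII x y hne hcon)
          rcases ((completion_adj_iff_of_isTypeII hII).1 h1).2 with h | h
          · refine ⟨x, h, fun hx => ht ?_⟩
            rw [mul_comm]
            exact p.ideal.mul_mem _ _ hx
          · exact ⟨y, h, fun hy => ht (p.ideal.mul_mem _ _ hy)⟩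
      · rintro ⟨x, hx, hxp⟩
        refine ⟨_, Or.inl ⟨x, ?_, rfl⟩, hxp⟩
        rintro ⟨l, rfl⟩
        exact inr_notMem_oldVerts l hx
    obtain ⟨e₁⟩ := nonempty_mulEquiv_aut isCoordinate_id hU (isPendant_top_of_isTypeII hE hI hII)
    exact ⟨(e₀.trans (MulEquiv.subgroupCongr (relGroup_completion_of_isTypeII hII))).trans e₁⟩
  · rw [show Γ.S = _ from (if_neg hI).trans (if_neg hII)]
    have hU (p : ProjPt (graphGrading Γ.completion)) :
        p ∈ basicOpens (graphGrading Γ.completion) Γ.oldIdeal ↔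
          ∃ i ∈ Γ.oldVerts, i ∈ IsCoordinate.supp (quotientHom Γ.completion) p := by
      rw [oldIdeal, mem_basicOpens_span]
      constructor
      · rintro ⟨_, ⟨w, rfl⟩, hw⟩
        exact ⟨_, inl_mem_oldVerts w, hw⟩
      · rintro ⟨_, ⟨w, rfl⟩, hw⟩
        exact ⟨_, ⟨w, rfl⟩, hw⟩
    obtain ⟨e₁⟩ := nonempty_mulEquiv_aut (isCoordinate_quotientHom Γ.completion) hU
      isPendant_completion
    exact ⟨e₀.trans e₁⟩

end LooseGraph

end

theorem mainTheorem10 {V : Type u} {E : Type v} (Γ : LooseGraph V E)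
    (hE : ∀ e : E, ∃ w : V, Γ.Inc w e) :
    Nonempty (Γ.autGroup ≃* CategoryTheory.Aut Γ.S) :=
  LooseGraph.nonempty_autGroup_mulEquiv_aut hE
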